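/- Let $p,q\ge 1$, $n=p+q$, and let $\mathbb R^{p,q}$ be $\mathbb R^n$ with the metric $\langle x,y\rangle_{p,q}=-\sum_{j\le p}x_jy_j+\sum_{j>p}x_jy_j$ and standard basis $e_1,\dots,e_n$. Put $\kappa_j=\langle e_j,e_j\rangle_{p,q}$ and $m=\lfloor n/2\rfloor$. Let $\Delta_{p,q}=\mathbb C^{2^m}$ carry its standard scalar product and Clifford multiplication $x\cdot\psi$ through the Dirac spinor representation of the Clifford algebra with relations $x\cdot y+y\cdot x=-2\langle x,y\rangle_{p,q}$ given by $$e_j\mapsto \tau(j)\,E\otimes\dots\otimes E\otimes U_{\sigma(j)}\otimes T\otimes\dots\otimes T\quad (j\le 2m,\ \lfloor (j-1)/2\rfloor \text{ factors } T,\ m \text{ factors in all}),$$ and, if $n=2m+1$, $e_n\mapsto \tau(n)\, i\,T\otimes\dots\otimes T$. Here $\tau(j)=i$ for $j\le p$ and $\tau(j)=1$ for $j>p$, $\sigma(j)=1$ for odd $j$ and $2$ for even $j$, $E$ is the identity, $U_1=\begin{pmatrix} i&0\\0&-i\end{pmatrix}$, $U_2=\begin{pmatrix}0&i\\ i&0\end{pmatrix}$,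 $T=\begin{pmatrix}0&-i\\ i&0\end{pmatrix}$. Endow $\mathbb R^{p,q}$ with its canonical spin structure and with the maximal time-like subbundle $\xi_e=\operatorname{span}(e_1,\dots,e_p)$. In the canonical global $\xi_e$-adapted spin frame, spinor fields are functions $\mathbb R^n\to\Delta_{p,q}$, the Hilbert space $L^2_{\xi_e}(S)$ is $L^2(\mathbb R^n,\Delta_{p,q})$ with Lebesgue measure, and the Dirac operator is the unbounded operator $$D\psi=\sum_{j=1}^n\kappa_j\, e_j\cdot\frac{\partial\psi}{\partial x^j},\qquad \operatorname{dom}D=C_0^\infty(\mathbb R^n,\Delta_{p,q}),$$ where $C_0^\infty$ denotes the smooth compactly supported functions. Let $\mathcal F$ be the unitary Fourier transform on $L^2(\mathbb R^n,\Delta_{p,q})$, given on $L^1\cap L^2$ by $(\mathcal F\psi)(x)=(2\pi)^{-n/2}\int_{\mathbb R^n} e^{-i\,x\cdot y}\psi(y)\,dy$ with the Euclidean product $x\cdot y$ in the exponent. Let $\theta(x)=(-x_1,\dots,-x_p,x_{p+1},\dots,x_n)$, and let $M_A$ be the operator of multiplication by $A(x)=i\,\theta(x)\cdot$ on its maximal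 domain $\{f\in L^2(\mathbb R^n,\Delta_{p,q}): x\mapsto A(x)f(x)\in L^2(\mathbb R^n,\Delta_{p,q})\}$. For an operator $B$ in a Hilbert space $H$, the resolvent set $\rho(B)$, point spectrum $\sigma_p(B)$, residual spectrum $\sigma_r(B)$ and continuous spectrum $\sigma_c(B)$ consist of the $\lambda\in\mathbb C$ for which, respectively: $\lambda-B$ is injective with dense range and bounded inverse (defined on the range); $\lambda-B$ is not injective; $\lambda-B$ is injective with non-dense range; $\lambda-B$ is injective with dense range and unbounded inverse. Put $\sigma(B)=\mathbb C\setminus\rho(B)$. Then: 1. $D=\mathcal F^{-1}M_0\,\mathcal F$, where $M_0$ is the restriction of $M_A$ to $\mathcal F(C_0^\infty(\mathbb R^n,\Delta_{p,q}))$; $D$ is closable, and its closure is $\bar D=\mathcal F^{-1}M_A\,\mathcal F$ (equalities of unbounded operators, including domains). 2. $\sigma(D)=\sigma(\bar D)=\sigma_c(\bar D)=\mathbb C$, and $\sigma_p(\bar D)=\sigma_r(\bar D)=\emptyset$. -/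

import Mathlib

open MeasureTheory
open scoped ContDiff

noncomputable section

namespace PseudoDirac

/-! ## Spectral parts of an unbounded operator -/

section Spectrum

variable {H : Type*} [NormedAddCommGroup H] [InnerProductSpace ℂ H]

/-- The operator `z - T`, defined on the domain of `T`. -/
def shifted (T : H →ₗ.[ℂ] H) (z : ℂ) : T.domain →ₗ[ℂ] H :=
  z • T.domain.subtype - T.toFun

/-- Point spectrum: `z - T` is not injective. -/
def pointSpectrum (T : H →ₗ.[ℂ] H) : Set ℂ :=
  {z | LinearMap.ker (shifted T z) ≠ ⊥}

/-- The inverse of `z - T`, from the range of `z - T` to the domain of `T`, is bounded (meaningful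
when `z - T` is injective). -/
def HasBoundedInverse (T : H →ₗ.[ℂ] H) (z : ℂ) : Prop :=
  ∃ C : ℝ, ∀ x : T.domain, ‖(x : H)‖ ≤ C * ‖shifted T z x‖

/-- Residual spectrum: `z - T` is injective and its range is not dense. -/
def residualSpectrum (T : H →ₗ.[ℂ] H) : Set ℂ :=
  {z | LinearMap.ker (shifted T z) = ⊥ ∧ ¬ Dense (LinearMap.range (shifted T z) : Set H)}

/-- Continuous spectrum: `z - T` is injective with dense range, and its inverse is unbounded. -/
def continuousSpectrum (T : H →ₗ.[ℂ] H) : Set ℂ :=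
  {z | LinearMap.ker (shifted T z) = ⊥ ∧ Dense (LinearMap.range (shifted T z) : Set H) ∧
    ¬ HasBoundedInverse T z}

/-- Resolvent set: `z - T` is injective with dense range, and its inverse is bounded. -/
def resolventSet (T : H →ₗ.[ℂ] H) : Set ℂ :=
  {z | LinearMap.ker (shifted T z) = ⊥ ∧ Dense (LinearMap.range (shifted T z) : Set H) ∧
    HasBoundedInverse T z}

/-- The spectrum: the complement of the resolvent set. -/
def spectrum (T : H →ₗ.[ℂ] H) : Set ℂ := (resolventSet T)ᶜ

/-- The operator `U⁻¹ T U`, whose domain is `{x | U x ∈ dom T}`, for a unitary `U`. -/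
def conjugate (U : H ≃ₗᵢ[ℂ] H) (T : H →ₗ.[ℂ] H) : H →ₗ.[ℂ] H where
  domain := T.domain.comap U.toLinearEquiv.toLinearMap
  toFun := U.symm.toLinearEquiv.toLinearMap ∘ₗ T.toFun ∘ₗ
    (U.toLinearEquiv.toLinearMap.restrict (p := T.domain.comap U.toLinearEquiv.toLinearMap)
      (q := T.domain) (fun _ hx => hx))

end Spectrum

/-! ## Multiplication operators -/

section Multiplication

variable {Ω : Type*} [MeasurableSpace Ω] {E : Type*} [NormedAddCommGroup E] [InnerProductSpace ℂ E]

/-- The maximal operator of pointwise multiplication by the family `A` on `L²(Ω, E)`: its domain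
consists of all `f ∈ L²` with `t ↦ A t (f t)` in `L²`. -/
def mulOperator (μ : Measure Ω) (A : Ω → E →L[ℂ] E) : Lp E 2 μ →ₗ.[ℂ] Lp E 2 μ where
  domain :=
    { carrier := {f | MemLp (fun t => A t (f t)) 2 μ}
      zero_mem' := by
        refine (MemLp.zero (ε := E)).ae_eq ?_
        filter_upwards [Lp.coeFn_zero E 2 μ] with t ht
        rw [ht]
        exact (map_zero (A t)).symm
      add_mem' := by
        intro f g hf hg
        refine (MemLp.add hf hg).ae_eq ?_
        filter_upwards [Lp.coeFn_add f g] with t ht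
        rw [ht]
        exact (map_add (A t) _ _).symm
      smul_mem' := by
        intro c f hf
        refine (MemLp.const_smul hf c).ae_eq ?_
        filter_upwards [Lp.coeFn_smul c f] with t ht
        rw [ht]
        exact (map_smul (A t) c _).symm }
  toFun :=
    { toFun := fun f => MemLp.toLp (fun t => A t ((f : Lp E 2 μ) t)) f.2
      map_add' := by
        intro f g
        rw [← MemLp.toLp_add]
        refine MemLp.toLp_congr _ _ ?_
        filter_upwards [Lp.coeFn_add (f : Lp E 2 μ) (g : Lp E 2 μ)] with t ht
        exact (congrArg (A t) ht).trans (map_add (A t) _ _)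
      map_smul' := by
        intro c f
        simp only [RingHom.id_apply]
        rw [← MemLp.toLp_const_smul]
        refine MemLp.toLp_congr _ _ ?_
        filter_upwards [Lp.coeFn_smul c (f : Lp E 2 μ)] with t ht
        exact (congrArg (A t) ht).trans (map_smul (A t) c _) }

end Multiplication

/-! ## The space `ℝ^{p,q}` -/

variable (p q : ℕ)

/-- `ℝⁿ`, `n = p + q`, with its Euclidean structure, which provides the Lebesgue measure and the
kernel of the Fourier transform; the indefinite metric is `metric p q`. -/
abbrev Space : Type := EuclideanSpace ℝ (Fin (p + q))

/-- The standard basis vector `e_j`. -/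
def stdVec (j : Fin (p + q)) : Space p q := EuclideanSpace.single j 1

/-- `κ_j = ⟨e_j, e_j⟩_{p,q}`: `-1` for the first `p` indices and `1` for the others. -/
def sgn (j : Fin (p + q)) : ℝ := if (j : ℕ) < p then -1 else 1

lemma sgn_mul_self (j : Fin (p + q)) : sgn p q j * sgn p q j = 1 := by
  unfold sgn; split_ifs <;> norm_num

/-- `⟨x, y⟩_{p,q} = -x₁y₁ - … - x_p y_p + x_{p+1} y_{p+1} + … + x_n y_n`. -/
def metric : LinearMap.BilinForm ℝ (Space p q) :=
  LinearMap.mk₂ ℝ (fun x y => ∑ j, sgn p q j * x j * y j)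
    (fun x x' y => by simp [mul_add, add_mul, Finset.sum_add_distrib])
    (fun c x y => by
      simp only [PiLp.smul_apply, smul_eq_mul, Finset.mul_sum]
      exact Finset.sum_congr rfl fun j _ => by ring)
    (fun x y y' => by simp [mul_add, Finset.sum_add_distrib])
    (fun c x y => by
      simp only [PiLp.smul_apply, smul_eq_mul, Finset.mul_sum]
      exact Finset.sum_congr rfl fun j _ => by ring)

lemma metric_apply (x y : Space p q) : metric p q x y = ∑ j, sgn p q j * x j * y j := rfl

lemma metric_stdVec (x : Space p q) (j : Fin (p + q)) :
    metric p q x (stdVec p q j) = sgn p q j * x j := by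
  simp [metric_apply, stdVec]

lemma metric_isSymm : (metric p q).IsSymm :=
  ⟨fun x y => by
    simp only [metric_apply]
    exact Finset.sum_congr rfl fun j _ => by ring⟩

lemma metric_nondegenerate : (metric p q).Nondegenerate := by
  refine (LinearMap.IsRefl.nondegenerate_iff_separatingLeft (metric_isSymm p q).isRefl).2 ?_
  intro x hx
  ext j
  have h := hx (stdVec p q j)
  rw [metric_stdVec] at h
  have h2 := sgn_mul_self p q j
  have : x j = sgn p q j * (sgn p q j * x j) := by rw [← mul_assoc, h2, one_mul]
  rw [this, h]; simp

/-- The musical isomorphism `♯ : (ℝⁿ)* ≅ ℝⁿ` of the indefinite metric, `⟨♯α, y⟩_{p,q} = α y`. -/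
def sharp : Module.Dual ℝ (Space p q) ≃ₗ[ℝ] Space p q :=
  ((metric p q).toDual (metric_nondegenerate p q)).symm

/-- The coordinate one-form `dx^j`. -/
def dx (j : Fin (p + q)) : Module.Dual ℝ (Space p q) := (EuclideanSpace.proj j).toLinearMap

/-- The linear reflection `θ` through the plane spanned by `e_{p+1}, …, e_n`:
`θ(x) = (-x₁, …, -x_p, x_{p+1}, …, x_n)`. -/
def theta (x : Space p q) : Space p q := WithLp.toLp 2 fun j => sgn p q j * x j

/-! ## The Clifford algebra and the Dirac spinor representation -/

/-- The quadratic form `x ↦ -⟨x, x⟩_{p,q}`, so that in its Clifford algebra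
`x · y + y · x = -2 ⟨x, y⟩_{p,q}`. -/
def cliffordForm : QuadraticForm ℝ (Space p q) := -(metric p q).toQuadraticMap

/-- The Clifford algebra `Cl_{p,q}`. -/
abbrev Cl : Type := CliffordAlgebra (cliffordForm p q)

/-- The index set of the standard basis of `ℂ^{2^m} = ℂ² ⊗ … ⊗ ℂ²`, with `m = ⌊n / 2⌋` factors. -/
abbrev SpinIdx : Type := Fin ((p + q) / 2) → Fin 2

/-- The spinor module `Δ_{p,q} = ℂ^{2^m}` with its standard positive definite scalar product. -/
abbrev Spinor : Type := EuclideanSpace ℂ (SpinIdx p q)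

def matU₁ : Matrix (Fin 2) (Fin 2) ℂ := !![Complex.I, 0; 0, -Complex.I]
def matU₂ : Matrix (Fin 2) (Fin 2) ℂ := !![0, Complex.I; Complex.I, 0]
def matT : Matrix (Fin 2) (Fin 2) ℂ := !![0, -Complex.I; Complex.I, 0]

/-- The Kronecker product `M 0 ⊗ M 1 ⊗ … ⊗ M (m - 1)` of `2 × 2` matrices. -/
def kron {m : ℕ} (M : Fin m → Matrix (Fin 2) (Fin 2) ℂ) :
    Matrix (Fin m → Fin 2) (Fin m → Fin 2) ℂ :=
  Matrix.of fun a b => ∏ k, M k (a k) (b k)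

/-- `U_{σ(j)}` for the index `j` counted from zero. -/
def matU (j : ℕ) : Matrix (Fin 2) (Fin 2) ℂ := if j % 2 = 0 then matU₁ else matU₂

/-- The `k`-th factor (from the left, from zero) of the Kronecker product for the `j`-th (from zero)
basis vector: the product is `E ⊗ … ⊗ E ⊗ U_{σ(j)} ⊗ T ⊗ … ⊗ T` with `⌊j / 2⌋` factors `T`. If
`n = 2m + 1` is odd and `j = 2m` is the last index, then all `m` factors are `T`. -/
def factor (m j : ℕ) (k : Fin m) : Matrix (Fin 2) (Fin 2) ℂ :=
  if m - 1 - (k : ℕ) < j / 2 then matT else if m - 1 - (k : ℕ) = j / 2 then matU j else 1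

/-- `τ(j)`, with `j` counted from zero. -/
def tau (j : ℕ) : ℂ := if j < p then Complex.I else 1

/-- The scalar in front of the Kronecker product; for `n = 2m + 1` the last basis vector is sent to
`τ · i · T ⊗ … ⊗ T`. -/
def coeff (j : ℕ) : ℂ := tau p j * if j = 2 * ((p + q) / 2) then Complex.I else 1

/-- The matrix by which `e_j` acts on spinors. -/
def gamma (j : Fin (p + q)) : Matrix (SpinIdx p q) (SpinIdx p q) ℂ :=
  coeff p q j • kron (factor ((p + q) / 2) j)

lemma kron_mul {m : ℕ} (M N : Fin m → Matrix (Fin 2) (Fin 2) ℂ) :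
    kron M * kron N = kron fun k => M k * N k := by
  ext a b
  simp only [kron, Matrix.mul_apply, Matrix.of_apply]
  rw [Finset.prod_univ_sum]
  simp [Finset.prod_mul_distrib]

lemma kron_smul {m : ℕ} (c : Fin m → ℂ) (M : Fin m → Matrix (Fin 2) (Fin 2) ℂ) :
    kron (fun k => c k • M k) = (∏ k, c k) • kron M := by
  ext a b
  simp [kron, Finset.prod_mul_distrib]

lemma kron_one {m : ℕ} : kron (fun _ : Fin m => (1 : Matrix (Fin 2) (Fin 2) ℂ)) = 1 := by
  ext a b
  simp only [kron, Matrix.of_apply, Matrix.one_apply]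
  by_cases h : a = b
  · simp [h]
  · rw [if_neg h]
    obtain ⟨k, hk⟩ := Function.ne_iff.mp h
    exact Finset.prod_eq_zero (Finset.mem_univ k) (by simp [hk])

lemma matT_sq : matT * matT = 1 := by
  ext i j; fin_cases i <;> fin_cases j <;> simp [matT, Matrix.mul_apply]

lemma matU_sq (j : ℕ) : matU j * matU j = (-1 : ℂ) • 1 := by
  unfold matU
  split_ifs <;> ext i j <;> fin_cases i <;> fin_cases j <;>
    simp [matU₁, matU₂, Matrix.mul_apply]

lemma matU_matT (j : ℕ) : matU j * matT = (-1 : ℂ) • (matT * matU j) := by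
  unfold matU
  split_ifs <;> ext i j <;> fin_cases i <;> fin_cases j <;>
    simp [matU₁, matU₂, matT, Matrix.mul_apply]

lemma matU_matU {j k : ℕ} (h : j / 2 = k / 2) (hjk : j < k) :
    matU j * matU k = (-1 : ℂ) • (matU k * matU j) := by
  have h1 : j % 2 = 0 := by omega
  have h2 : ¬ k % 2 = 0 := by omega
  unfold matU
  rw [if_pos h1, if_neg h2]
  ext a b
  fin_cases a <;> fin_cases b <;> simp [matU₁, matU₂, Matrix.mul_apply]

lemma prod_sign {m r : ℕ} (hr : r < m) :
    (∏ k : Fin m, if m - 1 - (k : ℕ) = r then (-1 : ℂ) else 1) = -1 := by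
  rw [Finset.prod_eq_single (⟨m - 1 - r, by omega⟩ : Fin m)]
  · rw [if_pos (by simp; omega)]
  · intro b _ hb
    rw [if_neg]
    intro hh
    apply hb
    ext
    simp
    omega
  · simp

lemma factor_sq (m j : ℕ) (k : Fin m) :
    factor m j k * factor m j k =
      (if m - 1 - (k : ℕ) = j / 2 then (-1 : ℂ) else 1) • (1 : Matrix (Fin 2) (Fin 2) ℂ) := by
  unfold factor
  split_ifs with h1 h2 h2
  · omega
  · rw [matT_sq, one_smul]
  · exact matU_sq j
  · simp

lemma factor_anti {m i j : ℕ} (hij : i < j) (k : Fin m) :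
    factor m i k * factor m j k =
      (if m - 1 - (k : ℕ) = i / 2 then (-1 : ℂ) else 1) • (factor m j k * factor m i k) := by
  have hd : i / 2 ≤ j / 2 := Nat.div_le_div_right hij.le
  unfold factor
  rcases lt_trichotomy (m - 1 - (k : ℕ)) (i / 2) with h | h | h
  · rw [if_pos h, if_pos (by omega), if_neg (by omega), one_smul]
  · rw [if_neg (by omega), if_pos h, if_pos h]
    by_cases h2 : i / 2 = j / 2
    · rw [if_neg (by omega), if_pos (by omega)]
      exact matU_matU h2 hij
    · rw [if_pos (by omega)]
      exact matU_matT i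
  · rw [if_neg (by omega : ¬ m - 1 - (k : ℕ) < i / 2), if_neg (by omega : ¬ m - 1 - (k : ℕ) = i / 2),
      if_neg (by omega : ¬ m - 1 - (k : ℕ) = i / 2)]
    simp

lemma gamma_sq (j : Fin (p + q)) : gamma p q j * gamma p q j = (-(sgn p q j : ℝ) : ℂ) • 1 := by
  have hj := j.2
  unfold gamma
  rw [smul_mul_smul_comm, kron_mul]
  simp only [factor_sq]
  rw [kron_smul, kron_one, smul_smul]
  congr 1
  have hc : (∏ k : Fin ((p + q) / 2), if (p + q) / 2 - 1 - (k : ℕ) = (j : ℕ) / 2 then (-1 : ℂ)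
      else 1) = if (j : ℕ) = 2 * ((p + q) / 2) then 1 else -1 := by
    split_ifs with h
    · refine Finset.prod_eq_one fun k _ => ?_
      rw [if_neg]
      have := k.2
      omega
    · exact prod_sign (by omega)
  rw [hc]
  unfold coeff tau sgn
  split_ifs <;> simp

lemma gamma_anti_of_lt {i j : Fin (p + q)} (h : i < j) :
    gamma p q i * gamma p q j + gamma p q j * gamma p q i = 0 := by
  have hi := i.2
  have hj := j.2
  have hij : (i : ℕ) < j := h
  unfold gamma
  rw [smul_mul_smul_comm, smul_mul_smul_comm, kron_mul, kron_mul]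
  simp only [factor_anti hij]
  rw [kron_smul, prod_sign (by omega), mul_comm (coeff p q j)]
  simp

lemma gamma_anti {i j : Fin (p + q)} (h : i ≠ j) :
    gamma p q i * gamma p q j + gamma p q j * gamma p q i = 0 := by
  rcases lt_or_gt_of_ne h with h | h
  · exact gamma_anti_of_lt p q h
  · rw [add_comm]; exact gamma_anti_of_lt p q h

/-- The linear map `ℝⁿ → Mat(2^m, ℂ)` with `e_j ↦ gamma j`. -/
def gammaLin : Space p q →ₗ[ℝ] Matrix (SpinIdx p q) (SpinIdx p q) ℂ where
  toFun x := ∑ j, x j • gamma p q j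
  map_add' x y := by simp [add_smul, Finset.sum_add_distrib]
  map_smul' c x := by simp [mul_smul, Finset.smul_sum]

lemma gammaLin_sq (x : Space p q) :
    gammaLin p q x * gammaLin p q x = algebraMap ℝ _ (cliffordForm p q x) := by
  have key : ∀ i j : Fin (p + q), (x i • gamma p q i) * (x j • gamma p q j) +
      (x j • gamma p q j) * (x i • gamma p q i) =
      if i = j then (-(2 * (sgn p q i * x i * x i))) • 1 else 0 := by
    intro i j
    split_ifs with h
    · subst h
      rw [smul_mul_smul_comm, gamma_sq, ← two_smul ℝ, ← Complex.ofReal_neg]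
      ext a b
      simp only [Matrix.smul_apply, smul_eq_mul, Complex.real_smul, Complex.ofReal_mul,
        Complex.ofReal_neg, Complex.ofReal_ofNat]
      ring
    · rw [smul_mul_smul_comm, smul_mul_smul_comm, mul_comm (x j), ← smul_add, gamma_anti p q h,
        smul_zero]
  have h2 : (2 : ℝ) • (gammaLin p q x * gammaLin p q x) =
      (2 : ℝ) • algebraMap ℝ _ (cliffordForm p q x) := by
    rw [two_smul]
    change (∑ j, x j • gamma p q j) * (∑ j, x j • gamma p q j) +
      (∑ j, x j • gamma p q j) * (∑ j, x j • gamma p q j) = _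
    rw [Finset.sum_mul_sum]
    nth_rewrite 2 [Finset.sum_comm]
    rw [← Finset.sum_add_distrib]
    simp only [← Finset.sum_add_distrib]
    simp only [key, Finset.sum_ite_eq, Finset.mem_univ, if_true]
    rw [← Finset.sum_smul, Algebra.algebraMap_eq_smul_one, smul_smul]
    congr 1
    change _ = 2 * -(metric p q x x)
    rw [metric_apply, Finset.sum_neg_distrib, ← Finset.mul_sum]
    ring
  exact smul_right_injective _ (two_ne_zero (α := ℝ)) h2

/-- The Dirac spinor representation `κ_{p,q}`, restricted from `Cl_{p,q} ⊗ ℂ` to `Cl_{p,q}`; for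
odd `n` it is the first of the two irreducible ones. -/
def spinRep : Cl p q →ₐ[ℝ] Matrix (SpinIdx p q) (SpinIdx p q) ℂ :=
  CliffordAlgebra.lift (cliffordForm p q) ⟨gammaLin p q, gammaLin_sq p q⟩

/-- Clifford multiplication of spinors by the vector `x`. -/
def cliffordMul (x : Space p q) : Spinor p q →L[ℂ] Spinor p q :=
  Matrix.toEuclideanCLM (𝕜 := ℂ) (spinRep p q (CliffordAlgebra.ι (cliffordForm p q) x))

/-! ## The Dirac operator

The canonical (and only) spin structure of `ℝ^{p,q}` is the trivial bundle `ℝⁿ × Spin₀(p,q)`. Its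
global section `x ↦ (x, 1)` identifies spinor fields with functions `ℝⁿ → Δ_{p,q}` and is adapted to
`ξ_e = span(e₁, …, e_p)`; in it the spinor derivative `∇ˢ` induced by the flat Levi-Civita
connection is the ordinary derivative, the bundle metric of `ξ_e` is the standard scalar product of
`Δ_{p,q}`, and the volume element is Lebesgue measure. -/

/-- The Hilbert space `L²_{ξ_e}(S) = L²(ℝⁿ, Δ_{p,q})`. -/
abbrev L2 : Type := Lp (Spinor p q) 2 (volume : Measure (Space p q))

/-- The Dirac differential operator `∇ˢ`, then `♯`, then Clifford multiplication:
`D ψ = ∑_j ♯(dx^j) · ∂_j ψ`. -/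
def diracDiff (ψ : Space p q → Spinor p q) (x : Space p q) : Spinor p q :=
  ∑ j, cliffordMul p q (sharp p q (dx p q j)) (fderiv ℝ ψ x (stdVec p q j))

/-- `C₀^∞(ℝⁿ, Δ_{p,q})`: the smooth compactly supported spinor fields. -/
def testSpinors : Submodule ℂ (Space p q → Spinor p q) where
  carrier := {ψ | ContDiff ℝ ∞ ψ ∧ HasCompactSupport ψ}
  zero_mem' := ⟨contDiff_const, HasCompactSupport.zero⟩
  add_mem' := fun hf hg => ⟨hf.1.add hg.1, hf.2.add hg.2⟩
  smul_mem' := fun c _ hf => ⟨hf.1.const_smul c, hf.2.smul_left (f := fun _ => c)⟩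

lemma memLp_testSpinor (ψ : testSpinors p q) : MemLp (ψ : Space p q → Spinor p q) 2 volume :=
  ψ.2.1.continuous.memLp_of_hasCompactSupport ψ.2.2

lemma diracDiff_mem (ψ : testSpinors p q) : diracDiff p q ψ ∈ testSpinors p q := by
  have h : diracDiff p q ψ = ∑ j, fun x => cliffordMul p q (sharp p q (dx p q j))
      (fderiv ℝ (ψ : Space p q → Spinor p q) x (stdVec p q j)) := by
    ext x
    simp [diracDiff]
  rw [h]
  refine Submodule.sum_mem _ fun j _ => ⟨?_, ?_⟩
  · have h1 : ContDiff ℝ ∞ (fderiv ℝ (ψ : Space p q → Spinor p q)) :=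
      ψ.2.1.fderiv_right (by simp)
    have h2 : ContDiff ℝ ∞ fun x =>
        fderiv ℝ (ψ : Space p q → Spinor p q) x (stdVec p q j) := h1.clm_apply contDiff_const
    generalize cliffordMul p q (sharp p q (dx p q j)) = B
    exact (B.restrictScalars ℝ).contDiff.comp h2
  · have h1 : HasCompactSupport fun x =>
        fderiv ℝ (ψ : Space p q → Spinor p q) x (stdVec p q j) :=
      (ψ.2.2.fderiv (𝕜 := ℝ)).comp_left
        (g := fun T : Space p q →L[ℝ] Spinor p q => T (stdVec p q j)) rfl
    generalize cliffordMul p q (sharp p q (dx p q j)) = B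
    exact h1.comp_left (g := fun v => B v) (map_zero B)

/-- `D` as a linear map of `C₀^∞(ℝⁿ, Δ_{p,q})` to itself. -/
def diracTest : testSpinors p q →ₗ[ℂ] testSpinors p q where
  toFun ψ := ⟨diracDiff p q ψ, diracDiff_mem p q ψ⟩
  map_add' ψ φ := by
    ext1
    funext x
    have h1 := (ψ.2.1.differentiable (by simp)) x
    have h2 := (φ.2.1.differentiable (by simp)) x
    simp [diracDiff, fderiv_add h1 h2, Finset.sum_add_distrib]
  map_smul' c ψ := by
    ext1
    funext x
    have h1 := (ψ.2.1.differentiable (by simp)) x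
    simp [diracDiff, fderiv_const_smul h1 c, Finset.smul_sum]

/-- The embedding of `C₀^∞(ℝⁿ, Δ_{p,q})` into `L²(ℝⁿ, Δ_{p,q})`. -/
def testToL2 : testSpinors p q →ₗ[ℂ] L2 p q where
  toFun ψ := (memLp_testSpinor p q ψ).toLp _
  map_add' _ _ := rfl
  map_smul' _ _ := rfl

lemma testToL2_injective : Function.Injective (testToL2 p q) := by
  intro ψ φ h
  have h' := (MemLp.toLp_eq_toLp_iff (memLp_testSpinor p q ψ) (memLp_testSpinor p q φ)).1 h
  exact Subtype.ext ((Continuous.ae_eq_iff_eq volume ψ.2.1.continuous φ.2.1.continuous).1 h')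

/-- The Dirac operator as an unbounded operator in `L²(ℝⁿ, Δ_{p,q})` with domain
`C₀^∞(ℝⁿ, Δ_{p,q})`. -/
def dirac : L2 p q →ₗ.[ℂ] L2 p q where
  domain := LinearMap.range (testToL2 p q)
  toFun := testToL2 p q ∘ₗ diracTest p q ∘ₗ
    (LinearEquiv.ofInjective (testToL2 p q) (testToL2_injective p q)).symm.toLinearMap

/-- The operator of multiplication by `A(x) = i θ(x) ·`, on its maximal domain. -/
def thetaOperator : L2 p q →ₗ.[ℂ] L2 p q :=
  mulOperator volume fun x => Complex.I • cliffordMul p q (theta p q x)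

/-- The unitary map `F` of `L²(ℝⁿ, Δ_{p,q})` is the Fourier transform: on `L¹ ∩ L²` it is given by
`(F ψ)(x) = (2π)^{-n/2} ∫ e^{-i ⟨x, y⟩} ψ(y) dy`, with the Euclidean `⟨x, y⟩`. As `L¹ ∩ L²` is dense
in `L²`, this determines `F`. -/
def IsFourierTransform (F : L2 p q ≃ₗᵢ[ℂ] L2 p q) : Prop :=
  ∀ ψ : L2 p q, Integrable ψ volume →
    F ψ =ᵐ[volume] fun x => (((2 * Real.pi) ^ (-((p + q : ℕ) : ℝ) / 2) : ℝ) : ℂ) •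
      ∫ y, Complex.exp (-Complex.I * ((inner ℝ x y : ℝ) : ℂ)) • ψ y

end PseudoDirac

end

set_option linter.unusedSectionVars false

/-! The unitary Fourier transform turns `∂_j` into multiplication by `i x_j`, and `♯(dx^j) = κ_j
e_j`, so the Dirac operator becomes multiplication by the symbol `A(x) = i θ(x)·`. Everything
spectral rests on `A(x)² = ⟨x,x⟩_{p,q}` (`symbol_symbol`), that is, on the factorization `(z - A)(z
+ A) = z² - ⟨x,x⟩`.

Closure. The maximal operator `M_A` of a continuous family is closed (`isClosed_mulOperator`) and
has the test functions as a core (`graph_mulOperator_le`). A test function on the Fourier side comes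
from a Schwartz function `s`, in general without compact support; the cutoffs `χ(εx) s` approximate
`(s, Ds)` in the graph of `D` with error `O(ε)` (`schwartz_mem_closure_graph_dirac`). Hence the
closure of `D` corresponds to all of `M_A`.

Spectrum. The quadric `⟨x,x⟩ = z²` is a null set, so `z - A(x)` is invertible for almost every `x`.
This makes `z - M_A` injective with dense range for every complex `z`. Its inverse is never bounded:
as `p, q ≥ 1`, there are a null vector `y` and a spinor `w` with `y·w ≠ 0`. At `θ(ty)` the square of
`A` vanishes, so `z - A` sends `z w + A w`, whose norm grows with `t`, to the fixed vector `z² w`.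
Functions concentrated near such points defeat every bound (`not_hasBoundedInverse_mulOperator`). A
bound for `D` itself would pass to the closure, so `D` has full spectrum too. -/

namespace PseudoDirac

/-! ### Unbounded operators: unitary conjugation, graphs and closures. -/

section SpectralTheory

variable {H : Type*} [NormedAddCommGroup H] [InnerProductSpace ℂ H]

lemma shifted_apply (T : H →ₗ.[ℂ] H) (z : ℂ) (x : T.domain) :
    shifted T z x = z • (x : H) - T x := rfl

lemma mem_graph_conjugate (U : H ≃ₗᵢ[ℂ] H) (T : H →ₗ.[ℂ] H) (a b : H) :
    (a, b) ∈ (conjugate U T).graph ↔ (U a, U b) ∈ T.graph := by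
  simp only [LinearPMap.mem_graph_iff]
  constructor
  · rintro ⟨y, rfl, rfl⟩
    exact ⟨⟨U y, y.2⟩, rfl, (U.apply_symm_apply _).symm⟩
  · rintro ⟨y, hy, hb⟩
    have ha : U a ∈ T.domain := hy ▸ y.2
    refine ⟨⟨a, ha⟩, rfl, ?_⟩
    have h : y = ⟨U a, ha⟩ := Subtype.ext hy
    change U.symm (T ⟨U a, ha⟩) = b
    rw [← h, hb, U.symm_apply_apply]

lemma isClosed_conjugate (U : H ≃ₗᵢ[ℂ] H) {T : H →ₗ.[ℂ] H} (hT : T.IsClosed) :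
    (conjugate U T).IsClosed := by
  have h : ((conjugate U T).graph : Set (H × H)) =
      (fun a : H × H => (U a.1, U a.2)) ⁻¹' T.graph := by
    ext ⟨a, b⟩
    exact mem_graph_conjugate U T a b
  unfold LinearPMap.IsClosed
  rw [h]
  exact IsClosed.preimage (by fun_prop) hT

lemma shifted_conjugate (U : H ≃ₗᵢ[ℂ] H) (T : H →ₗ.[ℂ] H) (z : ℂ)
    (x : (conjugate U T).domain) :
    shifted (conjugate U T) z x = U.symm (shifted T z ⟨U x, x.2⟩) := by
  simp only [shifted_apply, map_sub, map_smul, U.symm_apply_apply]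
  rfl

lemma ker_shifted_conjugate {U : H ≃ₗᵢ[ℂ] H} {T : H →ₗ.[ℂ] H} {z : ℂ}
    (h : LinearMap.ker (shifted T z) = ⊥) :
    LinearMap.ker (shifted (conjugate U T) z) = ⊥ := by
  rw [LinearMap.ker_eq_bot'] at h ⊢
  intro x hx
  rw [shifted_conjugate, map_eq_zero_iff _ U.symm.injective] at hx
  have := congrArg Subtype.val (h _ hx)
  exact Subtype.ext ((map_eq_zero_iff _ U.injective).1 this)

lemma dense_range_shifted_conjugate {U : H ≃ₗᵢ[ℂ] H} {T : H →ₗ.[ℂ] H} {z : ℂ}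
    (h : Dense (LinearMap.range (shifted T z) : Set H)) :
    Dense (LinearMap.range (shifted (conjugate U T) z) : Set H) := by
  have h2 := U.symm.surjective.denseRange.dense_image U.symm.continuous h
  refine h2.mono ?_
  rintro _ ⟨_, ⟨y, rfl⟩, rfl⟩
  refine ⟨⟨U.symm y, ?_⟩, ?_⟩
  · change U (U.symm y) ∈ T.domain
    rw [U.apply_symm_apply]
    exact y.2
  · rw [shifted_conjugate]
    congr 2
    exact Subtype.ext (U.apply_symm_apply _)

lemma hasBoundedInverse_of_conjugate {U : H ≃ₗᵢ[ℂ] H} {T : H →ₗ.[ℂ] H} {z : ℂ}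
    (h : HasBoundedInverse (conjugate U T) z) : HasBoundedInverse T z := by
  obtain ⟨C, hC⟩ := h
  refine ⟨C, fun y => ?_⟩
  have hy : U (U.symm y) ∈ T.domain := by
    rw [U.apply_symm_apply]
    exact y.2
  have := hC ⟨U.symm y, hy⟩
  rw [shifted_conjugate, U.symm.norm_map] at this
  simpa using this

/-- The estimate is a closed condition on pairs of the graph, so it survives passage to the closed
graph. This is how the spectrum of `D` is read off from that of its closure. -/
lemma HasBoundedInverse.closure {T : H →ₗ.[ℂ] H} {z : ℂ} (hT : T.IsClosable)
    (h : HasBoundedInverse T z) : HasBoundedInverse T.closure z := by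
  obtain ⟨C, hC⟩ := h
  refine ⟨C, fun x => ?_⟩
  have hx : ((x : H), T.closure x) ∈ _root_.closure (T.graph : Set (H × H)) := by
    have := T.closure.mem_graph x
    rwa [← hT.graph_closure_eq_closure_graph] at this
  have hcl : IsClosed {a : H × H | ‖a.1‖ ≤ C * ‖z • a.1 - a.2‖} :=
    isClosed_le (by fun_prop) (by fun_prop)
  refine closure_minimal ?_ hcl hx
  rintro ⟨a, b⟩ hab
  obtain ⟨y, rfl, rfl⟩ := (LinearPMap.mem_graph_iff _).1 hab
  exact hC y

/-- A closed subspace `G` of `H × H` contains every pair that is annihilated by all pairs `(u, v)`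
which annihilate `G`. -/
lemma mem_of_forall_inner_add_inner_eq_zero [CompleteSpace H] {G : Submodule ℂ (H × H)}
    (hG : IsClosed (G : Set (H × H))) {a b : H}
    (h : ∀ u v : H, (∀ c ∈ G, inner ℂ u c.1 + inner ℂ v c.2 = 0) →
      inner ℂ u a + inner ℂ v b = 0) : (a, b) ∈ G := by
  -- The sup norm on `H × H` is not Hilbertian; in the `ℓ²` product the claim is `Kᗮᗮ = K` for
  -- closed `K`.
  let e := WithLp.prodContinuousLinearEquiv 2 ℂ H H
  let K : Submodule ℂ (WithLp 2 (H × H)) := G.comap e.toLinearEquiv.toLinearMap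
  have hK : IsClosed (K : Set (WithLp 2 (H × H))) := hG.preimage e.continuous
  have hKK : Kᗮᗮ = K := by
    rw [Submodule.orthogonal_orthogonal_eq_closure]
    exact hK.submodule_topologicalClosure_eq
  have : e.symm (a, b) ∈ Kᗮᗮ := by
    rw [Submodule.mem_orthogonal]
    intro w hw
    rw [Submodule.mem_orthogonal'] at hw
    rw [WithLp.prod_inner_apply]
    refine h _ _ fun c hc => ?_
    have := hw (e.symm c) (by simpa [K] using hc)
    rwa [WithLp.prod_inner_apply] at this
  rw [hKK] at this
  simpa [K] using this

end SpectralTheory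

/-! ### Multiplication operators on `L²`. -/

section MulOperator

variable {Ω : Type*} [MeasurableSpace Ω] {E : Type*} [NormedAddCommGroup E]
  [InnerProductSpace ℂ E] {μ : Measure Ω} {A : Ω → E →L[ℂ] E}

/-- The domain condition disappears: an a.e. equality with some `h` in `L²` already forces `A f`
into `L²`. -/
lemma mem_graph_mulOperator (f h : Lp E 2 μ) :
    (f, h) ∈ (mulOperator μ A).graph ↔ (fun t => A t (f t)) =ᵐ[μ] h := by
  rw [LinearPMap.mem_graph_iff]
  constructor
  · rintro ⟨y, rfl, rfl⟩
    exact (MemLp.coeFn_toLp y.2).symm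
  · intro hh
    have hm : MemLp (fun t => A t (f t)) 2 μ := (Lp.memLp h).ae_eq hh.symm
    exact ⟨⟨f, hm⟩, rfl, Lp.ext ((MemLp.coeFn_toLp hm).trans hh)⟩

lemma coeFn_shifted_mulOperator (z : ℂ) (f : (mulOperator μ A).domain) :
    shifted (mulOperator μ A) z f =ᵐ[μ] fun t => z • (f : Lp E 2 μ) t - A t ((f : Lp E 2 μ) t) := by
  have h := (mem_graph_mulOperator _ _).1 ((mulOperator μ A).mem_graph f)
  rw [shifted_apply]
  filter_upwards [Lp.coeFn_sub (z • (f : Lp E 2 μ)) (mulOperator μ A f),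
    Lp.coeFn_smul z (f : Lp E 2 μ), h] with t h1 h2 h3
  rw [h1, Pi.sub_apply, h2, Pi.smul_apply, ← h3]

lemma ker_shifted_mulOperator {z : ℂ} (h : ∀ᵐ t ∂μ, ∀ v, z • v - A t v = 0 → v = 0) :
    LinearMap.ker (shifted (mulOperator μ A) z) = ⊥ := by
  rw [LinearMap.ker_eq_bot']
  intro f hf
  apply Subtype.ext
  change (f : Lp E 2 μ) = 0
  rw [Lp.eq_zero_iff_ae_eq_zero]
  have h0 := (Lp.eq_zero_iff_ae_eq_zero).1 hf
  filter_upwards [h, h0, coeFn_shifted_mulOperator z f] with t h1 h2 h3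
  exact h1 _ (h3 ▸ h2)

end MulOperator

/-! ### Multiplication by a continuous family: closedness, core, range and inverse. -/

section ContinuousFamily

variable {X : Type*} [NormedAddCommGroup X] [InnerProductSpace ℝ X] [FiniteDimensional ℝ X]
  [MeasurableSpace X] [BorelSpace X] {E : Type*} [NormedAddCommGroup E] [InnerProductSpace ℂ E]
  [CompleteSpace E] {A : X → E →L[ℂ] E}

/-- The class in `L²` of a continuous compactly supported function. -/
noncomputable def contToL2 (φ : X → E) (hc : Continuous φ) (hs : HasCompactSupport φ) :
    Lp E 2 (volume : Measure X) :=
  (hc.memLp_of_hasCompactSupport hs).toLp φ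

lemma coeFn_contToL2 (φ : X → E) (hc : Continuous φ) (hs : HasCompactSupport φ) :
    contToL2 φ hc hs =ᵐ[volume] φ := MemLp.coeFn_toLp _

lemma inner_contToL2 (φ : X → E) (hc : Continuous φ) (hs : HasCompactSupport φ)
    (u : Lp E 2 (volume : Measure X)) : inner ℂ (contToL2 φ hc hs) u = ∫ x, inner ℂ (φ x) (u x) := by
  rw [L2.inner_def]
  refine integral_congr_ae ?_
  filter_upwards [coeFn_contToL2 φ hc hs] with x hx
  rw [hx]

lemma integrable_inner_of_contToL2 {φ : X → E} (hc : Continuous φ) (hs : HasCompactSupport φ)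
    (u : Lp E 2 (volume : Measure X)) : Integrable fun x => inner ℂ (φ x) (u x) := by
  refine (L2.integrable_inner (𝕜 := ℂ) (contToL2 φ hc hs) u).congr ?_
  filter_upwards [coeFn_contToL2 φ hc hs] with x hx
  rw [hx]

lemma hasCompactSupport_clm_apply (A : X → E →L[ℂ] E) {φ : X → E} (hs : HasCompactSupport φ) :
    HasCompactSupport fun x => A x (φ x) :=
  hs.mono fun x hx hx' => hx (by simp [hx'])

/-- Testing against `g • w` with `g` scalar and `w` fixed reduces this to the fundamental lemma for
scalar test functions. -/
lemma ae_eq_zero_of_integral_inner_eq_zero {u : X → E} (hu : LocallyIntegrable u)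
    (h : ∀ φ : X → E, ContDiff ℝ ∞ φ → HasCompactSupport φ → ∫ x, inner ℂ (φ x) (u x) = 0) :
    ∀ᵐ x, u x = 0 := by
  refine ae_eq_zero_of_integral_contDiff_smul_eq_zero hu fun g hg hs => ?_
  have hi : Integrable fun x => g x • u x := hu.integrable_smul_left_of_hasCompactSupport hg.continuous hs
  refine ext_inner_left ℂ fun w => ?_
  rw [← integral_inner hi, inner_zero_right]
  have := h (fun x => g x • w) (hg.smul contDiff_const) (hs.smul_right (f' := fun _ => w))
  rw [← this]
  refine integral_congr_ae (.of_forall fun x => ?_)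
  simp only [← Complex.coe_smul, inner_smul_left, inner_smul_right, Complex.conj_ofReal]

/-- `A f` need not lie in `L²`, but `A` is bounded on compact sets, which suffices for testing. -/
lemma locallyIntegrable_clm_apply (hA : Continuous A) (f : Lp E 2 (volume : Measure X)) :
    LocallyIntegrable fun x => A x (f x) := by
  have hf : LocallyIntegrable (f : X → E) := (Lp.memLp f).locallyIntegrable (by norm_num)
  rw [locallyIntegrable_iff]
  intro K hK
  have h1 : IntegrableOn (fun x => f x) K := (locallyIntegrable_iff.1 hf) K hK
  obtain ⟨C, hC⟩ := hK.exists_bound_of_continuousOn hA.continuousOn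
  refine Integrable.mono' (h1.norm.const_mul C) ?_ ?_
  · exact (ContinuousLinearMap.apply ℂ E).flip.aestronglyMeasurable_comp₂
      hA.aestronglyMeasurable h1.aestronglyMeasurable
  · filter_upwards [ae_restrict_mem hK.measurableSet] with x hx
    exact ((A x).le_opNorm _).trans (mul_le_mul_of_nonneg_right (hC x hx) (norm_nonneg _))

lemma continuous_adjoint_family (hA : Continuous A) :
    Continuous fun x => ContinuousLinearMap.adjoint (A x) :=
  ContinuousLinearMap.adjoint.continuous.comp hA

/-- The maximal multiplication operator of a continuous family is closed. -/
lemma isClosed_mulOperator (hA : Continuous A) :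
    (mulOperator (volume : Measure X) A).IsClosed := by
  have hA' := continuous_adjoint_family hA
  -- The equation `A f = h` is tested weakly as `⟨A*φ, f⟩ = ⟨φ, h⟩`, and each such condition is
  -- continuous in `(f, h)`.
  have key : ((mulOperator (volume : Measure X) A).graph : Set _) =
      ⋂ (φ : X → E) (hc : ContDiff ℝ ∞ φ) (hs : HasCompactSupport φ),
        {a : Lp E 2 (volume : Measure X) × Lp E 2 (volume : Measure X) |
          inner ℂ (contToL2 _ (hA'.clm_apply hc.continuous) (hasCompactSupport_clm_apply _ hs)) a.1 =
            inner ℂ (contToL2 φ hc.continuous hs) a.2} := by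
    ext ⟨f, h⟩
    simp only [SetLike.mem_coe, mem_graph_mulOperator, Set.mem_iInter, Set.mem_ofPred_eq,
      inner_contToL2, ContinuousLinearMap.adjoint_inner_left]
    constructor
    · intro hf φ _ _
      refine integral_congr_ae ?_
      filter_upwards [hf] with x hx
      rw [hx]
    · intro hf
      have hl := (locallyIntegrable_clm_apply hA f).sub
        ((Lp.memLp h).locallyIntegrable (by norm_num))
      have := ae_eq_zero_of_integral_inner_eq_zero hl fun φ hc hs => ?_
      · filter_upwards [this] with x hx
        exact sub_eq_zero.1 hx
      · simp only [Pi.sub_apply, inner_sub_right]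
        rw [integral_sub, hf φ hc hs, sub_self]
        · have := integrable_inner_of_contToL2 (hA'.clm_apply hc.continuous)
            (hasCompactSupport_clm_apply _ hs) f
          simpa only [ContinuousLinearMap.adjoint_inner_left] using this
        · exact integrable_inner_of_contToL2 hc.continuous hs h
  unfold LinearPMap.IsClosed
  rw [key]
  refine isClosed_iInter fun φ => isClosed_iInter fun hc => isClosed_iInter fun hs => ?_
  exact isClosed_eq (by fun_prop) (by fun_prop)

/-- The smooth compactly supported functions are a core of the maximal multiplication operator of
a continuous family. -/
lemma graph_mulOperator_le (hA : Continuous A)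
    {G : Submodule ℂ (Lp E 2 (volume : Measure X) × Lp E 2 (volume : Measure X))}
    (hG : IsClosed (G : Set (Lp E 2 (volume : Measure X) × Lp E 2 (volume : Measure X))))
    (h : ∀ (φ : X → E) (hc : ContDiff ℝ ∞ φ) (hs : HasCompactSupport φ),
      (contToL2 φ hc.continuous hs, contToL2 _ (hA.clm_apply hc.continuous)
        (hasCompactSupport_clm_apply A hs)) ∈ G) :
    (mulOperator (volume : Measure X) A).graph ≤ G := by
  rintro ⟨f, k⟩ hf
  rw [mem_graph_mulOperator] at hf
  refine mem_of_forall_inner_add_inner_eq_zero hG fun u v huv => ?_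
  have hA' := continuous_adjoint_family hA
  -- A pair annihilating the test part of the graph satisfies a pointwise equation, and this kills
  -- every `(f, A f)`, not only smooth `f`.
  have hz : ∀ᵐ x, u x + ContinuousLinearMap.adjoint (A x) (v x) = 0 := by
    refine ae_eq_zero_of_integral_inner_eq_zero
      (((Lp.memLp u).locallyIntegrable (by norm_num)).add (locallyIntegrable_clm_apply hA' v))
      fun φ hc hs => ?_
    have h1 := huv _ (h φ hc hs)
    have h2 := congrArg (starRingEnd ℂ) h1
    simp only [map_add, inner_conj_symm, map_zero, inner_contToL2] at h2
    simp only [inner_add_right, ContinuousLinearMap.adjoint_inner_right]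
    rw [integral_add (integrable_inner_of_contToL2 hc.continuous hs u)
      (integrable_inner_of_contToL2 (hA.clm_apply hc.continuous)
        (hasCompactSupport_clm_apply A hs) v)]
    exact h2
  rw [L2.inner_def, L2.inner_def, ← integral_add (L2.integrable_inner u f) (L2.integrable_inner v k)]
  refine integral_eq_zero_of_ae ?_
  filter_upwards [hz, hf] with x hx hk
  rw [← hk, ← ContinuousLinearMap.adjoint_inner_left, ← inner_add_left, hx, inner_zero_left]
  rfl

lemma dense_range_shifted_mulOperator (hA : Continuous A) {z : ℂ}
    (h : ∀ᵐ x, ∀ v, ∃ w, z • w - A x w = v) :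
    Dense (LinearMap.range (shifted (mulOperator (volume : Measure X) A) z) :
      Set (Lp E 2 (volume : Measure X))) := by
  rw [Submodule.dense_iff_topologicalClosure_eq_top
      (s := LinearMap.range (shifted (mulOperator volume A) z)),
    Submodule.topologicalClosure_eq_top_iff,
    Submodule.eq_bot_iff]
  intro u hu
  rw [Submodule.mem_orthogonal] at hu
  let B : X → E →L[ℂ] E := fun x => z • ContinuousLinearMap.id ℂ E - A x
  have hB : Continuous B := continuous_const.sub hA
  -- Orthogonality to the range means `(z - A)* u = 0`; pointwise surjectivity of `z - A` then
  -- forces `u = 0`.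
  have hz : ∀ᵐ x, ContinuousLinearMap.adjoint (B x) (u x) = 0 := by
    refine ae_eq_zero_of_integral_inner_eq_zero
      (locallyIntegrable_clm_apply (continuous_adjoint_family hB) u) fun φ hc hs => ?_
    have hg := (mem_graph_mulOperator (μ := volume) (A := A) (contToL2 φ hc.continuous hs)
      (contToL2 _ (hA.clm_apply hc.continuous) (hasCompactSupport_clm_apply A hs))).2 (by
        filter_upwards [coeFn_contToL2 φ hc.continuous hs,
          coeFn_contToL2 _ (hA.clm_apply hc.continuous) (hasCompactSupport_clm_apply A hs)]
          with x h1 h2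
        rw [h1, h2])
    obtain ⟨f, hf, -⟩ := (LinearPMap.mem_graph_iff _).1 hg
    have h1 := hu _ ⟨f, rfl⟩
    rw [L2.inner_def] at h1
    rw [← h1]
    refine integral_congr_ae ?_
    have hf' : (f : Lp E 2 (volume : Measure X)) =ᵐ[volume] φ := by
      rw [hf]
      exact coeFn_contToL2 φ hc.continuous hs
    filter_upwards [coeFn_shifted_mulOperator z f, hf'] with x h1 h2
    rw [h1, h2, ContinuousLinearMap.adjoint_inner_right]
    rfl
  rw [Lp.eq_zero_iff_ae_eq_zero]
  filter_upwards [hz, h] with x h1 h2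
  obtain ⟨w, hw⟩ := h2 (u x)
  rw [Pi.zero_apply, ← inner_self_eq_zero (𝕜 := ℂ)]
  have h3 : B x w = u x := hw
  nth_rewrite 2 [← h3]
  rw [← ContinuousLinearMap.adjoint_inner_left, h1, inner_zero_left]

/-- By continuity, a pointwise violation at `x` with vector `v` persists on a small ball, so `v`
times the indicator of the ball violates the `L²` bound. -/
lemma not_hasBoundedInverse_mulOperator (hA : Continuous A) {z : ℂ}
    (h : ∀ C : ℝ, ∃ x v, C * ‖z • v - A x v‖ < ‖v‖) :
    ¬ HasBoundedInverse (mulOperator (volume : Measure X) A) z := by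
  rintro ⟨C, hC⟩
  obtain ⟨D, hD0, hCD⟩ : ∃ D : ℝ, 0 ≤ D ∧ C ≤ D := ⟨max C 0, le_max_right _ _, le_max_left _ _⟩
  obtain ⟨x, v, hxv⟩ := h D
  have hv : v ≠ 0 := by
    rintro rfl
    simp at hxv
  have hcont : Continuous fun y => D * ‖z • v - A y v‖ := by fun_prop
  -- The room between `c` and `‖v‖` gives `‖f‖ ≤ (c / ‖v‖) ‖f‖` with factor below `1`, which is
  -- absurd for `f ≠ 0`.
  obtain ⟨c, hc1, hc2⟩ := exists_between hxv
  have hc0 : 0 ≤ c := (by positivity : 0 ≤ D * ‖z • v - A x v‖).trans hc1.le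
  obtain ⟨ε, hε, hball⟩ := Metric.isOpen_iff.1 (isOpen_lt hcont continuous_const) x hc1
  have hfin : volume (Metric.ball x ε) ≠ ⊤ := measure_ball_lt_top.ne
  let f : Lp E 2 (volume : Measure X) := indicatorConstLp 2 measurableSet_ball hfin v
  have hf : f =ᵐ[volume] (Metric.ball x ε).indicator fun _ => v := indicatorConstLp_coeFn
  have hdom : f ∈ (mulOperator (volume : Measure X) A).domain := by
    change MemLp (fun t => A t (f t)) 2 volume
    have h1 : MemLp ((Metric.ball x ε).indicator fun y => A y v) 2 volume := by
      rw [memLp_indicator_iff_restrict measurableSet_ball]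
      have hAv : Continuous fun y => A y v := by fun_prop
      obtain ⟨M, hM⟩ := (isCompact_closedBall x ε).exists_bound_of_continuousOn hAv.continuousOn
      have : IsFiniteMeasure (volume.restrict (Metric.ball x ε)) := ⟨by simpa using hfin.lt_top⟩
      refine MemLp.of_bound hAv.aestronglyMeasurable M ?_
      filter_upwards [ae_restrict_mem measurableSet_ball] with y hy
      exact hM y (Metric.ball_subset_closedBall hy)
    refine h1.ae_eq ?_
    filter_upwards [hf] with y hy
    rw [hy]
    by_cases hy' : y ∈ Metric.ball x ε <;> simp [hy']
  have h1 := hC ⟨f, hdom⟩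
  have h2 : ‖(D : ℂ) • shifted (mulOperator (volume : Measure X) A) z ⟨f, hdom⟩‖ ≤
      (c / ‖v‖) * ‖f‖ := by
    refine Lp.norm_le_mul_norm_of_ae_le_mul ?_
    filter_upwards [Lp.coeFn_smul (D : ℂ) (shifted (mulOperator (volume : Measure X) A) z ⟨f, hdom⟩),
      coeFn_shifted_mulOperator z ⟨f, hdom⟩, hf] with y h1 h2 h3
    rw [h1, Pi.smul_apply, h2, norm_smul]
    simp only [h3]
    by_cases hy' : y ∈ Metric.ball x ε
    · have : D * ‖z • v - A y v‖ < c := hball hy'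
      have hvn : ‖v‖ ≠ 0 := norm_ne_zero_iff.2 hv
      simp only [Set.indicator_of_mem hy', div_mul_cancel₀ _ hvn]
      rw [Complex.norm_real, Real.norm_of_nonneg hD0]
      exact this.le
    · simp [hy']
  rw [norm_smul, Complex.norm_real, Real.norm_of_nonneg hD0] at h2
  have h3 : ‖f‖ ≤ c / ‖v‖ * ‖f‖ :=
    (h1.trans (mul_le_mul_of_nonneg_right hCD (norm_nonneg _))).trans h2
  have hpos : 0 < ‖f‖ := by
    rw [norm_indicatorConstLp (by norm_num) (by norm_num)]
    have : 0 < volume.real (Metric.ball x ε) :=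
      ENNReal.toReal_pos (Metric.measure_ball_pos _ _ hε).ne' hfin
    have := norm_pos_iff.2 hv
    positivity
  have h4 : c / ‖v‖ < 1 := (div_lt_one (norm_pos_iff.2 hv)).2 hc2
  nlinarith

end ContinuousFamily

/-! ### Unitary dilations of `L²`. -/

section Dilation

open Module

variable {X : Type*} [NormedAddCommGroup X] [InnerProductSpace ℝ X] [FiniteDimensional ℝ X]
  [MeasurableSpace X] [BorelSpace X] {E : Type*} [NormedAddCommGroup E] [InnerProductSpace ℂ E]
  [CompleteSpace E]

lemma quasiMeasurePreserving_smul {c : ℝ} (hc : c ≠ 0) :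
    Measure.QuasiMeasurePreserving (fun x : X => c • x) volume volume := by
  refine ⟨by fun_prop, ?_⟩
  rw [Measure.map_addHaar_smul _ hc]
  exact Measure.smul_absolutelyContinuous

lemma memLp_dilation {c : ℝ} (hc : c ≠ 0) {f : X → E} (hf : MemLp f 2 volume) :
    MemLp (fun x => ((Real.sqrt |c ^ finrank ℝ X| : ℝ) : ℂ) • f (c • x)) 2 volume := by
  have h1 : MemLp f 2 (Measure.map (fun x : X => c • x) volume) := by
    rw [Measure.map_addHaar_smul _ hc]
    exact hf.smul_measure ENNReal.ofReal_ne_top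
  exact (h1.comp_of_map (by fun_prop)).const_smul _

lemma norm_toLp_dilation {c : ℝ} (hc : c ≠ 0) (f : Lp E 2 (volume : Measure X)) :
    ‖(memLp_dilation hc (Lp.memLp f)).toLp _‖ = ‖f‖ := by
  have hc' : 0 < |c ^ finrank ℝ X| := abs_pos.2 (pow_ne_zero _ hc)
  have h : ‖(memLp_dilation hc (Lp.memLp f)).toLp _‖ ^ 2 = ‖f‖ ^ 2 := by
    rw [← inner_self_eq_norm_sq (𝕜 := ℂ), ← inner_self_eq_norm_sq (𝕜 := ℂ), L2.inner_def, L2.inner_def]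
    have h1 : ∫ x, inner ℂ ((memLp_dilation hc (Lp.memLp f)).toLp _ x)
        ((memLp_dilation hc (Lp.memLp f)).toLp _ x) =
        ∫ x, (fun y => ((|c ^ finrank ℝ X| : ℝ) : ℂ) * inner ℂ (f y) (f y)) (c • x) := by
      refine integral_congr_ae ?_
      filter_upwards [MemLp.coeFn_toLp (memLp_dilation hc (Lp.memLp f))] with x hx
      rw [hx, inner_smul_left, inner_smul_right, Complex.conj_ofReal, ← mul_assoc,
        ← Complex.ofReal_mul, Real.mul_self_sqrt hc'.le]
    rw [h1, Measure.integral_comp_smul volume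
      (fun y => ((|c ^ finrank ℝ X| : ℝ) : ℂ) * inner ℂ (f y) (f y)) c, integral_const_mul,
      ← Complex.coe_smul, smul_eq_mul,
      ← mul_assoc, ← Complex.ofReal_mul, abs_inv, inv_mul_cancel₀ hc'.ne', Complex.ofReal_one,
      one_mul]
  exact (pow_left_inj₀ (norm_nonneg _) (norm_nonneg _) two_ne_zero).1 h

/-- The isometry `f ↦ |c|^{d / 2} f (c ·)` of `L²`, where `d` is the dimension. -/
noncomputable def dilationIsometry {c : ℝ} (hc : c ≠ 0) :
    Lp E 2 (volume : Measure X) →ₗᵢ[ℂ] Lp E 2 (volume : Measure X) where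
  toFun f := (memLp_dilation hc (Lp.memLp f)).toLp _
  map_add' f g := by
    rw [← MemLp.toLp_add]
    refine MemLp.toLp_congr _ _ ?_
    filter_upwards [(quasiMeasurePreserving_smul hc).ae (Lp.coeFn_add f g)] with x hx
    rw [hx]
    exact smul_add _ _ _
  map_smul' a f := by
    rw [RingHom.id_apply, ← MemLp.toLp_const_smul]
    refine MemLp.toLp_congr _ _ ?_
    filter_upwards [(quasiMeasurePreserving_smul hc).ae (Lp.coeFn_smul a f)] with x hx
    rw [hx]
    exact smul_comm _ _ _
  norm_map' f := norm_toLp_dilation hc f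

lemma coeFn_dilationIsometry {c : ℝ} (hc : c ≠ 0) (f : Lp E 2 (volume : Measure X)) :
    dilationIsometry hc f =ᵐ[volume]
      fun x => ((Real.sqrt |c ^ finrank ℝ X| : ℝ) : ℂ) • f (c • x) :=
  MemLp.coeFn_toLp (memLp_dilation hc (Lp.memLp f))

lemma dilationIsometry_surjective {c : ℝ} (hc : c ≠ 0) :
    Function.Surjective (dilationIsometry hc :
      Lp E 2 (volume : Measure X) →ₗᵢ[ℂ] Lp E 2 (volume : Measure X)) := by
  intro f
  refine ⟨dilationIsometry (inv_ne_zero hc) f, Lp.ext ?_⟩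
  filter_upwards [coeFn_dilationIsometry hc (dilationIsometry (inv_ne_zero hc) f),
    (quasiMeasurePreserving_smul hc).ae (coeFn_dilationIsometry (inv_ne_zero hc) f)] with x h1 h2
  have hc' : |c ^ finrank ℝ X| ≠ 0 := abs_ne_zero.2 (pow_ne_zero _ hc)
  rw [h1, h2, smul_smul, smul_smul, inv_mul_cancel₀ hc, one_smul, ← Complex.ofReal_mul,
    ← Real.sqrt_mul (abs_nonneg _), inv_pow, abs_inv, mul_inv_cancel₀ hc', Real.sqrt_one,
    Complex.ofReal_one, one_smul]

/-- The unitary operator `f ↦ |c|^{d / 2} f (c ·)` of `L²`, where `d` is the dimension. -/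
noncomputable def dilation {c : ℝ} (hc : c ≠ 0) :
    Lp E 2 (volume : Measure X) ≃ₗᵢ[ℂ] Lp E 2 (volume : Measure X) :=
  LinearIsometryEquiv.ofSurjective (dilationIsometry hc) (dilationIsometry_surjective hc)

lemma coeFn_dilation {c : ℝ} (hc : c ≠ 0) (f : Lp E 2 (volume : Measure X)) :
    dilation hc f =ᵐ[volume] fun x => ((Real.sqrt |c ^ finrank ℝ X| : ℝ) : ℂ) • f (c • x) :=
  coeFn_dilationIsometry hc f

end Dilation

/-! ### The unitary Fourier transform with kernel `e^{-i⟨x,y⟩}`. -/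

section Fourier

open FourierTransform SchwartzMap Module

variable {X : Type*} [NormedAddCommGroup X] [InnerProductSpace ℝ X] [FiniteDimensional ℝ X]
  [MeasurableSpace X] [BorelSpace X] {E : Type*} [NormedAddCommGroup E] [InnerProductSpace ℂ E]
  [CompleteSpace E]

/-- On `L¹ ∩ L²` the `L²`-Fourier transform is the Fourier integral. -/
lemma coeFn_fourier_of_integrable (f : Lp E 2 (volume : Measure X)) (hf : Integrable f) :
    (𝓕 f : Lp E 2 (volume : Measure X)) =ᵐ[volume] 𝓕 (f : X → E) := by
  have hcont : Continuous (𝓕 (f : X → E)) :=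
    VectorFourier.fourierIntegral_continuous Real.continuous_fourierChar
      (innerSL ℝ).continuous₂ hf
  refine ae_eq_of_integral_contDiff_smul_eq ((Lp.memLp _).locallyIntegrable (by norm_num))
    hcont.locallyIntegrable fun g hg hs => ?_
  have hs' : HasCompactSupport (Complex.ofRealCLM ∘ g) := hs.comp_left rfl
  have hg' : ContDiff ℝ ∞ (Complex.ofRealCLM ∘ g) := by fun_prop
  let G : 𝓢(X, ℂ) := hs'.toSchwartzMap hg'
  -- Both transforms are tested against `G`: the `L²` one agrees with the distributional one, and
  -- the integral one moves onto `G` by Fubini.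
  have h1 := congrArg (fun T => T G) (Lp.fourier_toTemperedDistribution_eq f)
  simp only [TemperedDistribution.fourier_apply, Lp.toTemperedDistribution_apply] at h1
  have h2 := VectorFourier.integral_fourierIntegral_smul_eq_flip (L := innerₗ X)
    Real.continuous_fourierChar continuous_inner
    (G.integrable (μ := volume)) hf
  have hG : ∀ x, G x = (g x : ℂ) := fun x => rfl
  simp only [hG, Complex.coe_smul, flip_innerₗ] at h1 h2
  exact h1.symm.trans h2

lemma two_pi_inv_ne_zero : (2 * Real.pi)⁻¹ ≠ 0 := inv_ne_zero Real.two_pi_pos.ne'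

variable (X E) in
/-- The unitary Fourier transform with kernel `(2π)^{-d/2} e^{-i ⟨x, y⟩}`. -/
noncomputable def fourierUnitary :
    Lp E 2 (volume : Measure X) ≃ₗᵢ[ℂ] Lp E 2 (volume : Measure X) :=
  (Lp.fourierTransformₗᵢ X E).trans (dilation two_pi_inv_ne_zero)

lemma fourierUnitary_apply (f : Lp E 2 (volume : Measure X)) :
    fourierUnitary X E f = dilation two_pi_inv_ne_zero (𝓕 f) := rfl

lemma coeFn_fourierUnitary_of_integrable (f : Lp E 2 (volume : Measure X)) (hf : Integrable f) :
    fourierUnitary X E f =ᵐ[volume] fun x =>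
      (((2 * Real.pi) ^ (-(finrank ℝ X : ℝ) / 2) : ℝ) : ℂ) •
        ∫ y, Complex.exp (-Complex.I * ((inner ℝ x y : ℝ) : ℂ)) • f y := by
  have h2 := (quasiMeasurePreserving_smul (X := X) two_pi_inv_ne_zero).ae
    (coeFn_fourier_of_integrable f hf)
  filter_upwards [coeFn_dilation two_pi_inv_ne_zero (𝓕 f), h2] with x h1 h2
  rw [fourierUnitary_apply, h1, h2]
  congr 1
  · congr 1
    have hp := Real.two_pi_pos
    rw [abs_of_pos (by positivity), Real.sqrt_eq_rpow, ← Real.rpow_natCast, ← Real.rpow_mul (by positivity),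
      Real.inv_rpow hp.le, ← Real.rpow_neg hp.le]
    congr 1
    ring
  · rw [Real.fourier_eq]
    refine integral_congr_ae (.of_forall fun y => ?_)
    simp only [Circle.smul_def, Real.fourierChar_apply, inner_smul_right]
    congr 2
    rw [real_inner_comm]
    have := Real.pi_ne_zero
    push_cast
    field_simp

lemma coeFn_fourierUnitary_toLp (s : 𝓢(X, E)) :
    fourierUnitary X E (s.toLp 2) =ᵐ[volume] fun x =>
      ((Real.sqrt |((2 * Real.pi)⁻¹) ^ finrank ℝ X| : ℝ) : ℂ) • (𝓕 s) ((2 * Real.pi)⁻¹ • x) := by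
  rw [fourierUnitary_apply, SchwartzMap.toLp_fourier_eq]
  filter_upwards [coeFn_dilation two_pi_inv_ne_zero ((𝓕 s).toLp 2 : Lp E 2 (volume : Measure X)),
    (quasiMeasurePreserving_smul two_pi_inv_ne_zero).ae (coeFn_toLp (𝓕 s) 2 (volume : Measure X))]
    with x h1 h2
  rw [h1, h2]

/-- Every smooth compactly supported function is the unitary Fourier transform of a Schwartz
function. -/
lemma exists_fourierUnitary_toLp_eq {φ : X → E} (hc : ContDiff ℝ ∞ φ) (hs : HasCompactSupport φ) :
    ∃ s : 𝓢(X, E), fourierUnitary X E (s.toLp 2) = contToL2 φ hc.continuous hs := by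
  have hp : (2 * Real.pi) ≠ 0 := Real.two_pi_pos.ne'
  set a : ℝ := Real.sqrt |((2 * Real.pi)⁻¹) ^ finrank ℝ X| with ha
  have ha0 : a ≠ 0 := (Real.sqrt_pos.2 (abs_pos.2 (pow_ne_zero _ two_pi_inv_ne_zero))).ne'
  -- This rescaling undoes the dilation built into `fourierUnitary`.
  have hs1 : HasCompactSupport fun x : X => a⁻¹ • φ ((2 * Real.pi) • x) :=
    (hs.comp_smul hp).smul_left (f := fun _ => a⁻¹)
  have hc1 : ContDiff ℝ ∞ fun x : X => a⁻¹ • φ ((2 * Real.pi) • x) := by fun_prop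
  refine ⟨𝓕⁻ (hs1.toSchwartzMap hc1), Lp.ext ?_⟩
  filter_upwards [coeFn_fourierUnitary_toLp (𝓕⁻ (hs1.toSchwartzMap hc1)),
    coeFn_contToL2 φ hc.continuous hs] with x h1 h2
  rw [h1, h2, FourierTransform.fourier_fourierInv_eq]
  change (a : ℂ) • a⁻¹ • φ ((2 * Real.pi) • (2 * Real.pi)⁻¹ • x) = φ x
  rw [Complex.coe_smul, smul_smul, smul_smul, mul_inv_cancel₀ ha0, mul_inv_cancel₀ hp, one_smul,
    one_smul]

end Fourier

variable (p q : ℕ)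

/-! ### Clifford multiplication and the symbol. -/

section Clifford

lemma cliffordMul_eq (x : Space p q) :
    cliffordMul p q x = Matrix.toEuclideanCLM (𝕜 := ℂ) (gammaLin p q x) := by
  unfold cliffordMul spinRep
  rw [CliffordAlgebra.lift_ι_apply]

/-- Clifford multiplication as a linear map in the vector. -/
noncomputable def cliffordLin : Space p q →ₗ[ℝ] Spinor p q →L[ℂ] Spinor p q where
  toFun := cliffordMul p q
  map_add' x y := by simp only [cliffordMul_eq, map_add]
  map_smul' c x := by
    simp only [cliffordMul_eq, map_smul, RingHom.id_apply]
    exact map_smul (Matrix.toEuclideanCLM (n := SpinIdx p q) (𝕜 := ℂ)) (c : ℂ) _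

lemma cliffordLin_apply (x : Space p q) : cliffordLin p q x = cliffordMul p q x := rfl

lemma continuous_cliffordMul : Continuous (cliffordMul p q) :=
  (cliffordLin p q).continuous_of_finiteDimensional

lemma cliffordMul_cliffordMul (x : Space p q) (v : Spinor p q) :
    cliffordMul p q x (cliffordMul p q x v) = -((metric p q x x : ℝ) : ℂ) • v := by
  rw [← mul_apply_eq_comp, cliffordMul_eq, ← map_mul, gammaLin_sq,
    Algebra.algebraMap_eq_smul_one, ← Complex.coe_smul, map_smul, map_one]
  change (((-(metric p q x x) : ℝ) : ℂ) • (1 : Spinor p q →L[ℂ] Spinor p q)) v = _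
  simp

lemma metric_comm (x y : Space p q) : metric p q x y = metric p q y x := by
  simp only [metric_apply]
  exact Finset.sum_congr rfl fun j _ => by ring

lemma theta_apply (x : Space p q) (j : Fin (p + q)) : theta p q x j = sgn p q j * x j := rfl

lemma theta_theta (x : Space p q) : theta p q (theta p q x) = x := by
  ext j
  rw [theta_apply, theta_apply, ← mul_assoc, sgn_mul_self, one_mul]

lemma metric_theta (x : Space p q) :
    metric p q (theta p q x) (theta p q x) = metric p q x x := by
  simp only [metric_apply, theta_apply]
  refine Finset.sum_congr rfl fun j _ => ?_
  linear_combination sgn p q j * x j * x j * sgn_mul_self p q j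

lemma continuous_theta : Continuous (theta p q) := by
  unfold theta
  exact (PiLp.continuous_toLp 2 _).comp (by fun_prop)

lemma theta_eq_sum (x : Space p q) :
    theta p q x = ∑ j, x j • (sgn p q j • stdVec p q j) := by
  ext k
  simp [theta_apply, stdVec, mul_comm, Pi.single_apply, Finset.sum_apply]

lemma sharp_dx (j : Fin (p + q)) : sharp p q (dx p q j) = sgn p q j • stdVec p q j := by
  unfold sharp
  rw [LinearEquiv.symm_apply_eq]
  ext y
  change y j = metric p q (sgn p q j • stdVec p q j) y
  rw [map_smul, LinearMap.smul_apply, metric_comm, metric_stdVec, smul_eq_mul, ← mul_assoc,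
    sgn_mul_self, one_mul]

/-- The symbol `A(x) = i θ(x) ·` of the Dirac operator. -/
noncomputable def symbol (x : Space p q) : Spinor p q →L[ℂ] Spinor p q :=
  Complex.I • cliffordMul p q (theta p q x)

lemma thetaOperator_eq : thetaOperator p q = mulOperator volume (symbol p q) := rfl

lemma continuous_symbol : Continuous (symbol p q) :=
  ((continuous_cliffordMul p q).comp (continuous_theta p q)).const_smul Complex.I

/-- The factor `i` cancels the sign in the Clifford relation, and `θ` preserves the form. -/
lemma symbol_symbol (x : Space p q) (v : Spinor p q) :
    symbol p q x (symbol p q x v) = ((metric p q x x : ℝ) : ℂ) • v := by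
  simp only [symbol, smul_apply, map_smul, cliffordMul_cliffordMul,
    metric_theta, smul_smul]
  congr 1
  linear_combination -((metric p q x x : ℝ) : ℂ) * Complex.I_mul_I

lemma symbol_eq_sum (x : Space p q) (v : Spinor p q) :
    symbol p q x v =
      ∑ j, (Complex.I * (x j : ℂ)) • cliffordMul p q (sharp p q (dx p q j)) v := by
  rw [symbol, theta_eq_sum, ← cliffordLin_apply, map_sum, smul_apply,
    sum_apply, Finset.smul_sum]
  refine Finset.sum_congr rfl fun j _ => ?_
  rw [← sharp_dx, map_smul, mul_smul, Complex.coe_smul]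
  rfl

end Clifford

/-! ### Quadrics are null sets. -/

section Quadric

/-- The level sets of the quadratic form of the indefinite metric are null sets. -/
lemma ae_metric_ne (hn : 0 < p + q) (c : ℝ) : ∀ᵐ x : Space p q, metric p q x x ≠ c := by
  let j : Fin (p + q) := ⟨0, hn⟩
  let e := stdVec p q j
  have hcont : Continuous fun x : Space p q => metric p q x x := by
    simp only [metric_apply]
    fun_prop
  have hms : MeasurableSet {x : Space p q | metric p q x x ≠ c} :=
    (isOpen_ne_fun hcont continuous_const).measurableSet
  -- On each line parallel to `e` the form is a quadratic polynomial with leading coefficient `±1`,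
  -- hence takes the value `c` finitely often.
  refine ae_mem_of_ae_add_linearMap_mem (LinearMap.toSpanSingleton ℝ (Space p q) e)
    (μ := volume) (ν := volume) hms fun y => ?_
  let P : Polynomial ℝ := Polynomial.C (sgn p q j) * Polynomial.X ^ 2 +
    Polynomial.C (2 * metric p q y e) * Polynomial.X + Polynomial.C (metric p q y y - c)
  have hs : sgn p q j ≠ 0 := fun h => by simpa [h] using sgn_mul_self p q j
  have hP : P ≠ 0 := by
    intro h
    have := congrArg (fun r => Polynomial.coeff r 2) h
    simp [P] at this
    exact hs this
  have hfin := Polynomial.finite_setOfPred_isRoot hP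
  refine (measure_mono_null ?_ (hfin.measure_zero volume))
  intro t ht
  replace ht : metric p q (y + t • e) (y + t • e) = c := not_not.1 ht
  have he : metric p q e e = sgn p q j := by
    rw [metric_stdVec]
    simp [e, stdVec]
  have hsym : metric p q e y = metric p q y e := metric_comm p q e y
  change Polynomial.IsRoot P t
  simp only [map_add, map_smul, LinearMap.add_apply, LinearMap.smul_apply, smul_eq_mul, he,
    hsym] at ht
  simp only [P, Polynomial.IsRoot, Polynomial.eval_add, Polynomial.eval_mul, Polynomial.eval_C,
    Polynomial.eval_pow, Polynomial.eval_X]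
  linear_combination ht

lemma ae_sq_sub_metric_ne_zero (hn : 0 < p + q) (z : ℂ) :
    ∀ᵐ x : Space p q, z ^ 2 - ((metric p q x x : ℝ) : ℂ) ≠ 0 := by
  filter_upwards [ae_metric_ne p q hn (z ^ 2).re] with x hx h
  apply hx
  rw [sub_eq_zero.1 h, Complex.ofReal_re]

end Quadric

/-! ### Pointwise invertibility of `z - A(x)` and growth on the light cone. -/

section SymbolSpectrum

lemma injective_sub_symbol {z : ℂ} {x : Space p q}
    (hx : z ^ 2 - ((metric p q x x : ℝ) : ℂ) ≠ 0) (v : Spinor p q)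
    (hv : z • v - symbol p q x v = 0) : v = 0 := by
  have h : (z ^ 2 - ((metric p q x x : ℝ) : ℂ)) • v = 0 := by
    have h1 : z • v = symbol p q x v := sub_eq_zero.1 hv
    rw [sub_smul, ← symbol_symbol, ← h1, map_smul, ← h1, smul_smul, pow_two, sub_self]
  exact (smul_eq_zero.1 h).resolve_left hx

/-- Off the quadric this yields the inverse of `z - A(x)`; on the light cone it shows how large that
inverse becomes. -/
lemma sub_symbol_add_symbol (z : ℂ) (x : Space p q) (w : Spinor p q) :
    z • (z • w + symbol p q x w) - symbol p q x (z • w + symbol p q x w) =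
      (z ^ 2 - ((metric p q x x : ℝ) : ℂ)) • w := by
  rw [map_add, symbol_symbol, map_smul, smul_add, smul_smul, sub_smul, pow_two]
  abel

lemma surjective_sub_symbol {z : ℂ} {x : Space p q}
    (hx : z ^ 2 - ((metric p q x x : ℝ) : ℂ) ≠ 0) (v : Spinor p q) :
    ∃ w, z • w - symbol p q x w = v := by
  let w := (z ^ 2 - ((metric p q x x : ℝ) : ℂ))⁻¹ • v
  refine ⟨z • w + symbol p q x w, ?_⟩
  rw [sub_symbol_add_symbol, smul_smul, mul_inv_cancel₀ hx, one_smul]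

/-- Take `y` the sum of a time-like and a space-like basis vector. If it acted as zero, the two
would act as negatives of each other, yet their squares are `1` and `-1`. -/
lemma exists_null_cliffordMul_ne_zero (hp : 0 < p) (hq : 0 < q) :
    ∃ (y : Space p q) (w : Spinor p q), metric p q y y = 0 ∧ cliffordMul p q y w ≠ 0 := by
  let i : Fin (p + q) := ⟨0, by omega⟩
  let j : Fin (p + q) := ⟨p, by omega⟩
  have hij : i ≠ j := fun h => by
    have := congrArg Fin.val h
    simp only [i, j] at this
    omega
  have hi : sgn p q i = -1 := if_pos hp
  have hj : sgn p q j = 1 := if_neg (lt_irrefl p)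
  have hii : metric p q (stdVec p q i) (stdVec p q i) = -1 := by
    rw [metric_stdVec, hi]
    simp [stdVec]
  have hjj : metric p q (stdVec p q j) (stdVec p q j) = 1 := by
    rw [metric_stdVec, hj]
    simp [stdVec]
  have h_ij : metric p q (stdVec p q i) (stdVec p q j) = 0 := by
    rw [metric_stdVec]
    simp [stdVec, hij.symm]
  have h_ji : metric p q (stdVec p q j) (stdVec p q i) = 0 := by
    rw [metric_stdVec]
    simp [stdVec, hij]
  obtain ⟨w, hw⟩ := exists_ne (0 : Spinor p q)
  by_contra! hcon
  have h0 := fun v => hcon (stdVec p q i + stdVec p q j) v (by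
    simp only [map_add, LinearMap.add_apply, hii, hjj, h_ij, h_ji]
    norm_num)
  have h1 : ∀ v, cliffordMul p q (stdVec p q i) v = -cliffordMul p q (stdVec p q j) v := by
    intro v
    have := h0 v
    rw [← cliffordLin_apply, map_add] at this
    exact eq_neg_of_add_eq_zero_left this
  have h2 := cliffordMul_cliffordMul p q (stdVec p q i) w
  rw [h1, h1, map_neg, neg_neg, cliffordMul_cliffordMul, hii, hjj] at h2
  apply hw
  have h3 : (2 : ℂ) • w = 0 := by
    rw [two_smul]
    simpa [neg_eq_iff_add_eq_zero] using h2
  exact (smul_eq_zero.1 h3).resolve_left two_ne_zero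

lemma exists_mul_norm_sub_symbol_lt (hp : 0 < p) (hq : 0 < q) (z : ℂ) (C : ℝ) :
    ∃ (x : Space p q) (v : Spinor p q), C * ‖z • v - symbol p q x v‖ < ‖v‖ := by
  obtain ⟨y, w, hy, hw⟩ := exists_null_cliffordMul_ne_zero p q hp hq
  have hw' := norm_pos_iff.2 hw
  -- This makes the lower bound `t ‖y·w‖ - ‖z‖ ‖w‖` for the test vector exceed `C ‖z² w‖`.
  obtain ⟨t, ht⟩ := exists_gt ((C * (‖z‖ ^ 2 * ‖w‖) + ‖z‖ * ‖w‖) / ‖cliffordMul p q y w‖)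
  rw [div_lt_iff₀ hw'] at ht
  refine ⟨theta p q (t • y), z • w + symbol p q (theta p q (t • y)) w, ?_⟩
  have hm : metric p q (theta p q (t • y)) (theta p q (t • y)) = 0 := by
    rw [metric_theta, map_smul, map_smul, LinearMap.smul_apply, hy]
    simp
  have hs : ‖symbol p q (theta p q (t • y)) w‖ = |t| * ‖cliffordMul p q y w‖ := by
    rw [symbol, theta_theta, ← cliffordLin_apply, map_smul, smul_apply,
      norm_smul, smul_apply, norm_smul, cliffordLin_apply]
    simp
  rw [sub_symbol_add_symbol, hm, Complex.ofReal_zero, sub_zero, norm_smul, norm_pow]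
  have h1 : ‖symbol p q (theta p q (t • y)) w‖ - ‖z • w‖ ≤
      ‖z • w + symbol p q (theta p q (t • y)) w‖ := by
    simpa only [add_comm] using norm_sub_le_norm_add (symbol p q (theta p q (t • y)) w) (z • w)
  rw [hs, norm_smul] at h1
  nlinarith [mul_le_mul_of_nonneg_right (le_abs_self t) hw'.le]

end SymbolSpectrum

/-! ### The Dirac operator under the Fourier transform. -/

open FourierTransform SchwartzMap LineDeriv

section FourierPostcomp

variable {X : Type*} [NormedAddCommGroup X] [InnerProductSpace ℝ X] [FiniteDimensional ℝ X]
  [MeasurableSpace X] [BorelSpace X] {E : Type*} [NormedAddCommGroup E] [InnerProductSpace ℂ E]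
  [CompleteSpace E]

lemma fourier_postcompCLM_apply (L : E →L[ℂ] E) (s : 𝓢(X, E)) (ξ : X) :
    𝓕 (s.postcompCLM L) ξ = L (𝓕 s ξ) := by
  rw [fourier_coe, fourier_coe, Real.fourier_eq, Real.fourier_eq, ← L.integral_comp_comm]
  · refine integral_congr_ae (.of_forall fun y => ?_)
    simp [Circle.smul_def]
  · exact (Real.fourierIntegral_convergent_iff ξ).2 s.integrable

end FourierPostcomp

/-- The Dirac differential operator on Schwartz functions. -/
noncomputable def diracSchwartz (s : 𝓢(Space p q, Spinor p q)) : 𝓢(Space p q, Spinor p q) :=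
  ∑ j, (∂_{stdVec p q j} s).postcompCLM (cliffordMul p q (sharp p q (dx p q j)))

lemma coe_diracSchwartz (s : 𝓢(Space p q, Spinor p q)) :
    (diracSchwartz p q s : Space p q → Spinor p q) = diracDiff p q s := by
  ext1 x
  simp only [diracSchwartz, diracDiff, sum_apply, postcompCLM_apply,
    lineDerivOp_apply_eq_fderiv]

/-- With kernel `e^{-2πi⟨x,y⟩}` the derivative `∂_j` becomes `2πi ξ_j`; the dilation in
`fourierUnitary` later removes the `2π`. -/
lemma fourier_diracSchwartz_apply (s : 𝓢(Space p q, Spinor p q)) (ξ : Space p q) :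
    𝓕 (diracSchwartz p q s) ξ = symbol p q ((2 * Real.pi) • ξ) (𝓕 s ξ) := by
  have h : 𝓕 (diracSchwartz p q s) =
      ∑ j, 𝓕 ((∂_{stdVec p q j} s).postcompCLM (cliffordMul p q (sharp p q (dx p q j)))) :=
    map_sum (fourierCLM ℂ 𝓢(Space p q, Spinor p q)) _ _
  rw [h, sum_apply, symbol_eq_sum]
  refine Finset.sum_congr rfl fun j _ => ?_
  have ht : (fun x : Space p q => inner ℝ x (stdVec p q j)).HasTemperateGrowth :=
    ((innerSL ℝ).flip (stdVec p q j)).hasTemperateGrowth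
  have hi : inner ℝ ξ (stdVec p q j) = ξ j := by
    rw [stdVec, EuclideanSpace.inner_single_right]
    simp
  rw [fourier_postcompCLM_apply, fourier_lineDerivOp_eq, smul_apply,
    smulLeftCLM_apply_apply ht, hi, ← Complex.coe_smul, smul_smul, map_smul]
  congr 1
  simp
  ring

/-- The unitary Fourier transform turns the Dirac operator into multiplication by its symbol. -/
lemma fourierUnitary_diracSchwartz (s : 𝓢(Space p q, Spinor p q)) :
    (fourierUnitary (Space p q) (Spinor p q) (s.toLp 2),
      fourierUnitary (Space p q) (Spinor p q) ((diracSchwartz p q s).toLp 2)) ∈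
      (thetaOperator p q).graph := by
  rw [thetaOperator_eq, mem_graph_mulOperator]
  filter_upwards [coeFn_fourierUnitary_toLp s, coeFn_fourierUnitary_toLp (diracSchwartz p q s)]
    with x h1 h2
  rw [h1, h2, fourier_diracSchwartz_apply, map_smul, smul_smul,
    mul_inv_cancel₀ Real.two_pi_pos.ne', one_smul]

/-- A smooth compactly supported spinor field as a Schwartz function. -/
noncomputable def testToSchwartz (ψ : testSpinors p q) : 𝓢(Space p q, Spinor p q) :=
  HasCompactSupport.toSchwartzMap ψ.2.2 ψ.2.1

lemma toLp_testToSchwartz (ψ : testSpinors p q) :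
    (testToSchwartz p q ψ).toLp 2 = testToL2 p q ψ := rfl

lemma toLp_diracSchwartz_testToSchwartz (ψ : testSpinors p q) :
    (diracSchwartz p q (testToSchwartz p q ψ)).toLp 2 = testToL2 p q (diracTest p q ψ) := by
  refine MemLp.toLp_congr ((diracSchwartz p q (testToSchwartz p q ψ)).memLp 2 volume)
    (memLp_testSpinor p q (diracTest p q ψ)) (.of_eq ?_)
  rw [coe_diracSchwartz]
  rfl

lemma dirac_testToL2 (ψ : testSpinors p q) :
    dirac p q ⟨testToL2 p q ψ, ψ, rfl⟩ = testToL2 p q (diracTest p q ψ) := by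
  have h : (LinearEquiv.ofInjective (testToL2 p q) (testToL2_injective p q)).symm
      ⟨testToL2 p q ψ, ψ, rfl⟩ = ψ := by
    rw [LinearEquiv.symm_apply_eq]
    rfl
  exact congrArg (fun φ => testToL2 p q (diracTest p q φ)) h

lemma mem_graph_dirac (a b : L2 p q) :
    (a, b) ∈ (dirac p q).graph ↔
      ∃ ψ, testToL2 p q ψ = a ∧ testToL2 p q (diracTest p q ψ) = b := by
  rw [LinearPMap.mem_graph_iff]
  constructor
  · rintro ⟨⟨_, ψ, rfl⟩, rfl, rfl⟩
    exact ⟨ψ, rfl, (dirac_testToL2 p q ψ).symm⟩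
  · rintro ⟨ψ, rfl, rfl⟩
    exact ⟨⟨_, ψ, rfl⟩, rfl, dirac_testToL2 p q ψ⟩

lemma fourierUnitary_testToL2 (ψ : testSpinors p q) :
    (fourierUnitary (Space p q) (Spinor p q) (testToL2 p q ψ),
      fourierUnitary (Space p q) (Spinor p q) (testToL2 p q (diracTest p q ψ))) ∈
      (thetaOperator p q).graph := by
  rw [← toLp_testToSchwartz, ← toLp_diracSchwartz_testToSchwartz]
  exact fourierUnitary_diracSchwartz p q _

lemma dirac_eq_conjugate :
    dirac p q = conjugate (fourierUnitary (Space p q) (Spinor p q))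
      ((thetaOperator p q).domRestrict ((dirac p q).domain.map
        (fourierUnitary (Space p q) (Spinor p q)).toLinearEquiv.toLinearMap)) := by
  refine LinearPMap.eq_of_eq_graph (Submodule.ext ?_)
  rintro ⟨a, b⟩
  rw [mem_graph_conjugate, mem_graph_dirac, LinearPMap.mem_graph_iff]
  constructor
  · rintro ⟨ψ, rfl, rfl⟩
    have hg := fourierUnitary_testToL2 p q ψ
    obtain ⟨f, hf1, hf2⟩ := (LinearPMap.mem_graph_iff _).1 hg
    -- The domain of `domRestrict` is an intersection, so membership in the domain of `M_A` is
    -- needed as well; the graph relation supplies it.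
    refine ⟨⟨fourierUnitary (Space p q) (Spinor p q) (testToL2 p q ψ),
      ⟨⟨testToL2 p q ψ, ⟨ψ, rfl⟩, rfl⟩, LinearPMap.mem_domain_of_mem_graph hg⟩⟩, rfl, ?_⟩
    rw [← hf2]
    exact LinearPMap.domRestrict_apply hf1.symm
  · rintro ⟨y, hya, hyb⟩
    obtain ⟨⟨_, ⟨ψ, rfl⟩, hψ⟩, hy⟩ := y.2
    have ha : testToL2 p q ψ = a :=
      (fourierUnitary (Space p q) (Spinor p q)).injective (hψ.trans hya)
    refine ⟨ψ, ha, (fourierUnitary (Space p q) (Spinor p q)).injective ?_⟩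
    have hg : (fourierUnitary (Space p q) (Spinor p q) a,
        fourierUnitary (Space p q) (Spinor p q) b) ∈ (thetaOperator p q).graph :=
      (LinearPMap.mem_graph_iff _).2 ⟨⟨y, hy⟩, hya, (LinearPMap.domRestrict_apply rfl).symm.trans hyb⟩
    refine LinearPMap.mem_graph_snd_inj _ (fourierUnitary_testToL2 p q ψ) hg ?_
    rw [ha]

/-! ### Schwartz functions lie in the domain of the closure. -/

section Cutoff

/-- A smooth function that is `1` on the unit ball and vanishes outside the ball of radius `2`. -/
noncomputable def unitBump : ContDiffBump (0 : Space p q) where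
  rIn := 1
  rOut := 2
  rIn_pos := one_pos
  rIn_lt_rOut := one_lt_two

/-- After scaling, the cutoff error is at most `ε ‖x‖`, and Schwartz decay absorbs `‖x‖`. -/
lemma abs_unitBump_sub_one_le (x : Space p q) : |unitBump p q x - 1| ≤ ‖x‖ := by
  rcases le_or_gt ‖x‖ 1 with h | h
  · rw [(unitBump p q).one_of_mem_closedBall (by simpa [unitBump] using h)]
    simp
  · have h0 := (unitBump p q).nonneg (x := x)
    have h1 := (unitBump p q).le_one (x := x)
    rw [abs_le]
    constructor <;> linarith

/-- The cutoff `χ(ε x) s(x)` of a Schwartz function. -/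
noncomputable def cutoff {ε : ℝ} (hε : 0 < ε) (s : 𝓢(Space p q, Spinor p q)) : testSpinors p q :=
  ⟨fun x => unitBump p q (ε • x) • s x, by
    have h1 : ContDiff ℝ ∞ fun x : Space p q => unitBump p q (ε • x) :=
      (unitBump p q).contDiff.comp (contDiff_const_smul ε)
    exact ⟨h1.smul (s.smooth ⊤),
      ((unitBump p q).hasCompactSupport.comp_smul hε.ne').smul_right⟩⟩

lemma coe_cutoff {ε : ℝ} (hε : 0 < ε) (s : 𝓢(Space p q, Spinor p q)) (x : Space p q) :
    (cutoff p q hε s : Space p q → Spinor p q) x = unitBump p q (ε • x) • s x := rfl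

lemma diracDiff_cutoff {ε : ℝ} (hε : 0 < ε) (s : 𝓢(Space p q, Spinor p q)) (x : Space p q) :
    diracDiff p q (cutoff p q hε s) x = unitBump p q (ε • x) • diracSchwartz p q s x +
      ε • ∑ j, fderiv ℝ (unitBump p q) (ε • x) (stdVec p q j) •
        cliffordMul p q (sharp p q (dx p q j)) (s x) := by
  have hb : DifferentiableAt ℝ (unitBump p q) (ε • x) :=
    ((unitBump p q).contDiff (n := 1)).differentiable (by simp) _
  have h1 : HasFDerivAt (fun y : Space p q => unitBump p q (ε • y))
      ((fderiv ℝ (unitBump p q) (ε • x)).comp (ε • ContinuousLinearMap.id ℝ (Space p q))) x :=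
    hb.hasFDerivAt.comp x ((hasFDerivAt_id x).const_smul ε)
  have h2 := (h1.smul (s.hasFDerivAt x)).fderiv
  have h3 : fderiv ℝ (cutoff p q hε s : Space p q → Spinor p q) x = _ := h2
  rw [coe_diracSchwartz]
  unfold diracDiff
  rw [h3, Finset.smul_sum, Finset.smul_sum, ← Finset.sum_add_distrib]
  refine Finset.sum_congr rfl fun j _ => ?_
  generalize cliffordMul p q (sharp p q (dx p q j)) = B
  simp [smul_smul]

lemma norm_le_of_ae_norm_le_mul {f : L2 p q} {G : Space p q → ℝ} (hG : MemLp G 2 volume) {ε : ℝ}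
    (h : ∀ᵐ x, ‖f x‖ ≤ ε * ‖G x‖) : ‖f‖ ≤ ε * ‖hG.toLp G‖ := by
  refine Lp.norm_le_mul_norm_of_ae_le_mul ?_
  filter_upwards [h, hG.coeFn_toLp] with x h1 h2
  rwa [h2]

lemma memLp_norm_mul_norm (s : 𝓢(Space p q, Spinor p q)) :
    MemLp (fun x => ‖x‖ * ‖s x‖) 2 volume := by
  -- The weight `‖x‖` is not smooth at the origin, so it is dominated by a smooth one.
  have ht : (fun x : Space p q => 1 + ‖x‖ ^ 2).HasTemperateGrowth := by fun_prop
  refine ((smulLeftCLM (Spinor p q) (fun x : Space p q => 1 + ‖x‖ ^ 2) s).memLp 2 volume).mono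
    (by fun_prop) (.of_forall fun x => ?_)
  rw [smulLeftCLM_apply_apply ht, norm_smul, norm_mul, norm_norm, norm_norm]
  refine mul_le_mul_of_nonneg_right ?_ (norm_nonneg _)
  rw [Real.norm_of_nonneg (by positivity)]
  nlinarith [sq_nonneg (‖x‖ - 1)]

lemma norm_unitBump_smul_sub_le {ε : ℝ} (hε : 0 < ε) (s : 𝓢(Space p q, Spinor p q))
    (x : Space p q) : ‖unitBump p q (ε • x) • s x - s x‖ ≤ ε * (‖x‖ * ‖s x‖) := by
  have h : unitBump p q (ε • x) • s x - s x = (unitBump p q (ε • x) - 1) • s x := by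
    rw [sub_smul, one_smul]
  rw [h, norm_smul, ← mul_assoc]
  refine mul_le_mul_of_nonneg_right ?_ (norm_nonneg _)
  refine (abs_unitBump_sub_one_le p q _).trans_eq ?_
  rw [norm_smul, Real.norm_of_nonneg hε.le]

lemma exists_norm_cutoff_sub_le (s : 𝓢(Space p q, Spinor p q)) :
    ∃ C, ∀ (ε : ℝ) (hε : 0 < ε), ‖testToL2 p q (cutoff p q hε s) - s.toLp 2 volume‖ ≤ ε * C := by
  refine ⟨_, fun ε hε => norm_le_of_ae_norm_le_mul p q (memLp_norm_mul_norm p q s) ?_⟩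
  filter_upwards [Lp.coeFn_sub (testToL2 p q (cutoff p q hε s)) (s.toLp 2 volume),
    s.coeFn_toLp 2 volume, (memLp_testSpinor p q (cutoff p q hε s)).coeFn_toLp] with x h1 h2 h3
  have h3' : testToL2 p q (cutoff p q hε s) x = _ := h3
  rw [h1, Pi.sub_apply, h2, h3', coe_cutoff, norm_mul, norm_norm, norm_norm]
  exact norm_unitBump_smul_sub_le p q hε s x

lemma exists_norm_dirac_cutoff_sub_le (s : 𝓢(Space p q, Spinor p q)) :
    ∃ C, ∀ (ε : ℝ) (hε : 0 < ε), ‖testToL2 p q (diracTest p q (cutoff p q hε s)) -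
      (diracSchwartz p q s).toLp 2 volume‖ ≤ ε * C := by
  have hcd : Continuous (fderiv ℝ (unitBump p q)) :=
    ((unitBump p q).contDiff (n := 1)).continuous_fderiv (by simp)
  obtain ⟨M, hM⟩ := hcd.bounded_above_of_compact_support
    ((unitBump p q).hasCompactSupport.fderiv (𝕜 := ℝ))
  have hM0 : 0 ≤ M := (norm_nonneg _).trans (hM 0)
  -- `K` bounds the Leibniz term in which the derivative falls on the cutoff; the scaling gives that
  -- term its factor `ε`.
  let K : ℝ := ∑ j, M * ‖cliffordMul p q (sharp p q (dx p q j))‖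
  have hK : 0 ≤ K := Finset.sum_nonneg fun j _ => mul_nonneg hM0 (norm_nonneg _)
  refine ⟨_, fun ε hε => norm_le_of_ae_norm_le_mul p q
    ((memLp_norm_mul_norm p q (diracSchwartz p q s)).add ((s.memLp 2 volume).norm.const_mul K)) ?_⟩
  filter_upwards [Lp.coeFn_sub (testToL2 p q (diracTest p q (cutoff p q hε s)))
      ((diracSchwartz p q s).toLp 2 volume), (diracSchwartz p q s).coeFn_toLp 2 volume,
    (memLp_testSpinor p q (diracTest p q (cutoff p q hε s))).coeFn_toLp] with x h1 h2 h3
  have h3' : testToL2 p q (diracTest p q (cutoff p q hε s)) x =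
    diracDiff p q (cutoff p q hε s) x := h3
  rw [h1, Pi.sub_apply, h2, h3', diracDiff_cutoff, add_sub_right_comm]
  have hG : 0 ≤ ‖x‖ * ‖diracSchwartz p q s x‖ + K * ‖s x‖ := by positivity
  rw [Pi.add_apply, Real.norm_of_nonneg hG, mul_add]
  refine (norm_add_le _ _).trans (add_le_add (norm_unitBump_smul_sub_le p q hε _ x) ?_)
  rw [norm_smul, Real.norm_of_nonneg hε.le]
  refine mul_le_mul_of_nonneg_left ?_ hε.le
  refine (norm_sum_le _ _).trans ?_
  rw [Finset.sum_mul]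
  refine Finset.sum_le_sum fun j _ => ?_
  rw [norm_smul, mul_assoc]
  refine mul_le_mul ?_ (ContinuousLinearMap.le_opNorm _ _) (norm_nonneg _) hM0
  refine ((fderiv ℝ (unitBump p q) (ε • x)).le_opNorm _).trans ?_
  have : ‖stdVec p q j‖ = 1 := by simp [stdVec]
  rw [this, mul_one]
  exact hM _

lemma schwartz_mem_closure_graph_dirac (s : 𝓢(Space p q, Spinor p q)) :
    ((s.toLp 2, (diracSchwartz p q s).toLp 2) : L2 p q × L2 p q) ∈
      (dirac p q).graph.topologicalClosure := by
  obtain ⟨C, hC⟩ := exists_norm_cutoff_sub_le p q s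
  obtain ⟨C', hC'⟩ := exists_norm_dirac_cutoff_sub_le p q s
  rw [← SetLike.mem_coe, Submodule.topologicalClosure_coe, Metric.mem_closure_iff]
  intro δ hδ
  let ε := δ / (|C| + |C'| + 1)
  have hε : 0 < ε := by positivity
  refine ⟨(testToL2 p q (cutoff p q hε s), testToL2 p q (diracTest p q (cutoff p q hε s))),
    (mem_graph_dirac p q _ _).2 ⟨_, rfl, rfl⟩, ?_⟩
  have hεδ : ε * (|C| + |C'| + 1) = δ := div_mul_cancel₀ _ (by positivity)
  rw [dist_comm, Prod.dist_eq, max_lt_iff, dist_eq_norm, dist_eq_norm]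
  constructor
  · refine (hC ε hε).trans_lt ?_
    rw [← hεδ]
    exact mul_lt_mul_of_pos_left (by linarith [le_abs_self C, abs_nonneg C']) hε
  · refine (hC' ε hε).trans_lt ?_
    rw [← hεδ]
    exact mul_lt_mul_of_pos_left (by linarith [le_abs_self C', abs_nonneg C]) hε

end Cutoff

/-! ### The closure of the Dirac operator. -/

section Closure

lemma isClosed_conjugate_thetaOperator :
    (conjugate (fourierUnitary (Space p q) (Spinor p q)) (thetaOperator p q)).IsClosed :=
  isClosed_conjugate _ (isClosed_mulOperator (continuous_symbol p q))

lemma topologicalClosure_graph_dirac : (dirac p q).graph.topologicalClosure =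
    (conjugate (fourierUnitary (Space p q) (Spinor p q)) (thetaOperator p q)).graph := by
  refine le_antisymm ?_ ?_
  · refine Submodule.topologicalClosure_minimal _ ?_ (isClosed_conjugate_thetaOperator p q)
    rintro ⟨a, b⟩ hab
    obtain ⟨ψ, rfl, rfl⟩ := (mem_graph_dirac p q a b).1 hab
    exact (mem_graph_conjugate _ _ _ _).2 (fourierUnitary_testToL2 p q ψ)
  · let U := fourierUnitary (Space p q) (Spinor p q)
    let V : L2 p q × L2 p q →L[ℂ] L2 p q × L2 p q :=
      (U.symm.toContinuousLinearEquiv.toContinuousLinearMap).prodMap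
        U.symm.toContinuousLinearEquiv.toContinuousLinearMap
    -- The closed graph is carried to the Fourier side, where it suffices to check the core of test
    -- functions.
    let G := (dirac p q).graph.topologicalClosure.comap V.toLinearMap
    have hG : IsClosed (G : Set (L2 p q × L2 p q)) :=
      (Submodule.isClosed_topologicalClosure _).preimage V.continuous
    have hle : (thetaOperator p q).graph ≤ G := by
      refine graph_mulOperator_le (continuous_symbol p q) hG fun φ hc hs => ?_
      obtain ⟨s, hsφ⟩ := exists_fourierUnitary_toLp_eq hc hs
      have h1 := fourierUnitary_diracSchwartz p q s
      rw [hsφ] at h1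
      have h2 : (contToL2 φ hc.continuous hs, contToL2 _
          ((continuous_symbol p q).clm_apply hc.continuous) (hasCompactSupport_clm_apply _ hs)) ∈
          (thetaOperator p q).graph := by
        rw [thetaOperator_eq, mem_graph_mulOperator]
        filter_upwards [coeFn_contToL2 φ hc.continuous hs, coeFn_contToL2 _
          ((continuous_symbol p q).clm_apply hc.continuous)
          (hasCompactSupport_clm_apply (symbol p q) hs)] with x h3 h4
        rw [h3, h4]
      have h3 := LinearPMap.mem_graph_snd_inj _ h2 h1 rfl
      change (U.symm (contToL2 φ hc.continuous hs), U.symm (contToL2 _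
        ((continuous_symbol p q).clm_apply hc.continuous) (hasCompactSupport_clm_apply _ hs))) ∈
        (dirac p q).graph.topologicalClosure
      rw [h3, ← hsφ]
      simp only [U, LinearIsometryEquiv.symm_apply_apply]
      exact schwartz_mem_closure_graph_dirac p q s
    rintro ⟨a, b⟩ hab
    have h := hle ((mem_graph_conjugate _ _ _ _).1 hab)
    change (U.symm (U a), U.symm (U b)) ∈ (dirac p q).graph.topologicalClosure at h
    simpa only [LinearIsometryEquiv.symm_apply_apply] using h

lemma isClosable_dirac : (dirac p q).IsClosable := ⟨_, topologicalClosure_graph_dirac p q⟩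

lemma closure_dirac : (dirac p q).closure =
    conjugate (fourierUnitary (Space p q) (Spinor p q)) (thetaOperator p q) := by
  refine LinearPMap.eq_of_eq_graph ?_
  rw [← (isClosable_dirac p q).graph_closure_eq_closure_graph, topologicalClosure_graph_dirac]

end Closure

/-! ### Spectral conclusions. -/

section DiracSpectrum

lemma isFourierTransform_fourierUnitary :
    IsFourierTransform p q (fourierUnitary (Space p q) (Spinor p q)) := by
  intro ψ hψ
  have h := coeFn_fourierUnitary_of_integrable ψ hψ
  rwa [finrank_euclideanSpace_fin] at h

variable {p q}

lemma ker_shifted_closure_dirac (hn : 0 < p + q) (z : ℂ) :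
    LinearMap.ker (shifted (dirac p q).closure z) = ⊥ := by
  rw [closure_dirac]
  refine ker_shifted_conjugate (ker_shifted_mulOperator ?_)
  filter_upwards [ae_sq_sub_metric_ne_zero p q hn z] with x hx v hv
  exact injective_sub_symbol p q hx v hv

lemma dense_range_shifted_closure_dirac (hn : 0 < p + q) (z : ℂ) :
    Dense (LinearMap.range (shifted (dirac p q).closure z) : Set (L2 p q)) := by
  rw [closure_dirac]
  refine dense_range_shifted_conjugate
    (dense_range_shifted_mulOperator (continuous_symbol p q) ?_)
  filter_upwards [ae_sq_sub_metric_ne_zero p q hn z] with x hx v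
  exact surjective_sub_symbol p q hx v

lemma not_hasBoundedInverse_closure_dirac (hp : 0 < p) (hq : 0 < q) (z : ℂ) :
    ¬ HasBoundedInverse (dirac p q).closure z := by
  rw [closure_dirac]
  exact fun h => not_hasBoundedInverse_mulOperator (continuous_symbol p q)
    (exists_mul_norm_sub_symbol_lt p q hp hq z) (hasBoundedInverse_of_conjugate h)

lemma not_hasBoundedInverse_dirac (hp : 0 < p) (hq : 0 < q) (z : ℂ) :
    ¬ HasBoundedInverse (dirac p q) z :=
  fun h => not_hasBoundedInverse_closure_dirac hp hq z (h.closure (isClosable_dirac p q))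

end DiracSpectrum

end PseudoDirac

theorem mainTheorem3 (p q : ℕ) (hp : 0 < p) (hq : 0 < q) :
    (∃ F : PseudoDirac.L2 p q ≃ₗᵢ[ℂ] PseudoDirac.L2 p q,
      PseudoDirac.IsFourierTransform p q F ∧
      PseudoDirac.dirac p q = PseudoDirac.conjugate F
        ((PseudoDirac.thetaOperator p q).domRestrict
          ((PseudoDirac.dirac p q).domain.map F.toLinearEquiv.toLinearMap)) ∧
      (PseudoDirac.dirac p q).IsClosable ∧
      (PseudoDirac.dirac p q).closure =
        PseudoDirac.conjugate F (PseudoDirac.thetaOperator p q)) ∧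
    PseudoDirac.spectrum (PseudoDirac.dirac p q) = Set.univ ∧
    PseudoDirac.spectrum (PseudoDirac.dirac p q).closure = Set.univ ∧
    PseudoDirac.continuousSpectrum (PseudoDirac.dirac p q).closure = Set.univ ∧
    PseudoDirac.pointSpectrum (PseudoDirac.dirac p q).closure = ∅ ∧
    PseudoDirac.residualSpectrum (PseudoDirac.dirac p q).closure = ∅ := by
  have hn : 0 < p + q := Nat.add_pos_left hp q
  refine ⟨⟨_, PseudoDirac.isFourierTransform_fourierUnitary p q,
    PseudoDirac.dirac_eq_conjugate p q, PseudoDirac.isClosable_dirac p q,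
    PseudoDirac.closure_dirac p q⟩, ?_, ?_, ?_, ?_, ?_⟩
  · exact Set.eq_univ_of_forall fun z hz =>
      PseudoDirac.not_hasBoundedInverse_dirac hp hq z hz.2.2
  · exact Set.eq_univ_of_forall fun z hz =>
      PseudoDirac.not_hasBoundedInverse_closure_dirac hp hq z hz.2.2
  · exact Set.eq_univ_of_forall fun z => ⟨PseudoDirac.ker_shifted_closure_dirac hn z,
      PseudoDirac.dense_range_shifted_closure_dirac hn z,
      PseudoDirac.not_hasBoundedInverse_closure_dirac hp hq z⟩
  · exact Set.eq_empty_of_forall_notMem fun z hz =>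
      hz (PseudoDirac.ker_shifted_closure_dirac hn z)
  · exact Set.eq_empty_of_forall_notMem fun z hz =>
      hz.2 (PseudoDirac.dense_range_shifted_closure_dirac hn z)
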